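/- Let $\Omega\subset\mathbb{R}^{D}$ be a bounded connected open set with $C^2$ boundary and outward unit normal $\mathbf n$, let $\nu>0$, $\lambda\ge 0$, $t_0<T\le+\infty$, and let the external force $\mathbf g$ be such that, for each $t\in(t_0,T)$, $\mathbf g(\cdot,t)$ is continuous on $\overline\Omega$ and $C^1$ in $\Omega$. *Regularity.* A velocity field $\mathbf v$ is called regular if $\mathbf v$ and its first space derivatives are continuous on $[t_0,T)\times\overline\Omega$; $\partial_t\mathbf v$ and the second space derivatives are continuous on $(t_0,T)\times\overline\Omega$; and, for $t\in(t_0,T)$, $\mathbf v(\cdot,t)\in C^3(\Omega)$ and $\partial_t\mathbf v(\cdot,t)\in C^1(\Omega)$, with $\nabla\partial_t\mathbf v$ continuous on $(t_0,T)\times\Omega$. A pressure is called regular if for each $t\in(t_0,T)$ it belongs to $C^1(\overline\Omega)\cap C^2(\Omega)$ in space. *INSE.* A pair $(\mathbf u,p)$ of regular fields solves the no-slip incompressible Navier–Stokes equations (INSE) on $[t_0,T)$ if $\partial_t\mathbf u+\mathbf u\cdot\nabla\mathbf u=\mathbf g-\nabla p+\nu\Delta\mathbf u$ in $\Omega$ for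 $t\in(t_0,T)$, and $\nabla\cdot\mathbf u=0$ in $\Omega$ and $\mathbf u=\mathbf 0$ on $\partial\Omega$ for $t\in[t_0,T)$. *GePUP-E.* A triple $(\mathbf w,\mathbf u,q)$ of regular fields solves GePUP-E on $[t_0,T)$ if (a) $\partial_t\mathbf w=\mathbf g-\mathbf u\cdot\nabla\mathbf u-\nabla q+\nu\Delta\mathbf w$ in $\Omega$, (b) $\mathbf w\cdot\boldsymbol\tau=0$ for every tangent vector $\boldsymbol\tau$, and $\nabla\cdot\mathbf w=0$, on $\partial\Omega$, (c) $\mathbf u=\mathscr P\mathbf w$ in $\Omega$, where $\mathscr P$ is the Leray–Helmholtz projection, that is, $\mathbf w=\mathbf u-\nabla\phi$ on $\overline\Omega$ for some scalar function $\phi(\cdot,t)\in C^1(\overline\Omega)\cap C^2(\Omega)$, with $\nabla\cdot\mathbf u=0$ in $\Omega$ and $\mathbf u\cdot\mathbf n=0$ on $\partial\Omega$, (d) $\mathbf u\cdot\mathbf n=0$ on $\partial\Omega$, (e) $\Delta q=\nabla\cdot(\mathbf g-\mathbf u\cdot\nabla\mathbf u)$ in $\Omega$, (f) $\mathbf n\cdot\nabla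 q=\mathbf n\cdot(\mathbf g-\mathbf u\cdot\nabla\mathbf u+\nu\Delta\mathbf w)+\lambda\,\mathbf n\cdot\mathbf w$ on $\partial\Omega$, where (a), (e), (f) hold for $t\in(t_0,T)$ and (b), (c), (d) for $t\in[t_0,T)$. The initial condition is (IC): $\mathbf w(\cdot,t_0)=\mathbf u(\cdot,t_0)$ on $\overline\Omega$. **Theorem.** GePUP-E with (IC) is equivalent to the INSE. More precisely: 1. If $(\mathbf w,\mathbf u,q)$ solves GePUP-E and satisfies (IC), then $\mathbf w=\mathbf u$ on $[t_0,T)\times\overline\Omega$ and $(\mathbf u,q)$ solves the INSE. 2. If $(\mathbf u,p)$ solves the INSE, then $(\mathbf u,\mathbf u,p)$ solves GePUP-E. 3. For every $\mathbf u$: there is a $p$ such that $(\mathbf u,p)$ solves the INSE if and only if there are $\mathbf w$ and $q$ such that $(\mathbf w,\mathbf u,q)$ solves GePUP-E and satisfies (IC). 4. (Derivation of GePUP-E from the INSE.) Let $(\mathbf u,p)$ solve the INSE and let $\mathbf u=\mathbf w+\nabla\phi$ on $[t_0,T)\times\overline\Omega$, where $\mathbf w$ is regular, $\phi(\cdot,t)\in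 C^1(\overline\Omega)$ for each $t\in[t_0,T)$, and $\partial_t\phi$ exists on $(t_0,T)\times\overline\Omega$, is $C^1(\overline\Omega)$ in space for each $t$, and is continuous together with $\nabla\partial_t\phi$ on $(t_0,T)\times\overline\Omega$. Then there is a $q$ such that $(\mathbf w,\mathbf u,q)$ solves GePUP-E (the condition (IC) is not required here) if and only if $\mathbf w$ satisfies (b), the heat equation $\partial_t(\nabla\cdot\mathbf w)=\nu\Delta(\nabla\cdot\mathbf w)$ in $\Omega$ for $t\in(t_0,T)$, and $\partial_t(\mathbf n\cdot\mathbf w)=-\lambda\,\mathbf n\cdot\mathbf w$ on $\partial\Omega$ for $t\in(t_0,T)$. -/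

import Mathlib

open Set

noncomputable section

namespace GePUP

/-- The Euclidean space `ℝ^D`. -/
abbrev Euc (D : ℕ) : Type := EuclideanSpace ℝ (Fin D)

/-- A bounded connected open subset of `ℝ^D` with `C²` boundary, the boundary being given by a
defining function `ρ`: negative inside, zero exactly on the boundary, and regular there. -/
structure C2Domain (D : ℕ) where
  carrier : Set (Euc D)
  ρ : Euc D → ℝ
  isOpen : IsOpen carrier
  isConnected : IsConnected carrier
  isBounded : Bornology.IsBounded carrier
  contDiff_ρ : ContDiff ℝ 2 ρ
  carrier_eq : carrier = {x | ρ x < 0}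
  frontier_eq : frontier carrier = {x | ρ x = 0}
  gradient_ne_zero : ∀ x ∈ frontier carrier, gradient ρ x ≠ 0

variable {D : ℕ}

/-- The closure of the domain. -/
def C2Domain.cl (Ω : C2Domain D) : Set (Euc D) := closure Ω.carrier

/-- The boundary of the domain. -/
def C2Domain.bd (Ω : C2Domain D) : Set (Euc D) := frontier Ω.carrier

/-- The outward unit normal `n = ∇ρ / |∇ρ|`, used at boundary points only. -/
def C2Domain.normal (Ω : C2Domain D) (x : Euc D) : Euc D :=
  ‖gradient Ω.ρ x‖⁻¹ • gradient Ω.ρ x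

/-- The `i`-th partial derivative of a function on the closed domain.  At interior points this is
the usual partial derivative; at boundary points it is the one-sided one, which for a function
that is `C¹` up to the boundary is the limit of the interior values. -/
def pd {F : Type*} [NormedAddCommGroup F] [NormedSpace ℝ F] (Ω : C2Domain D) (i : Fin D)
    (f : Euc D → F) (x : Euc D) : F :=
  fderivWithin ℝ f Ω.cl x (EuclideanSpace.single i 1)

/-- The gradient `∇f`. -/
def grad (Ω : C2Domain D) (f : Euc D → ℝ) (x : Euc D) : Euc D :=
  WithLp.toLp 2 fun i => pd Ω i f x

/-- The divergence `∇ · v`. -/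
def dvg (Ω : C2Domain D) (v : Euc D → Euc D) (x : Euc D) : ℝ :=
  ∑ i, pd Ω i v x i

/-- The Laplacian of a scalar field, or the componentwise Laplacian of a vector field. -/
def lap {F : Type*} [NormedAddCommGroup F] [NormedSpace ℝ F] (Ω : C2Domain D)
    (f : Euc D → F) (x : Euc D) : F :=
  ∑ i, pd Ω i (pd Ω i f) x

/-- The convection term `v · ∇v`. -/
def convect (Ω : C2Domain D) (v : Euc D → Euc D) (x : Euc D) : Euc D :=
  ∑ i, v x i • pd Ω i v x

/-- The time derivative `∂f/∂t` at time `t` and position `x`. -/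
def dt {F : Type*} [NormedAddCommGroup F] [NormedSpace ℝ F] (f : ℝ → Euc D → F)
    (t : ℝ) (x : Euc D) : F :=
  deriv (fun s => f s x) t

/-- The time interval `[t₀, T)`; here `T` may be `+∞`. -/
def timeCO (t₀ : ℝ) (T : EReal) : Set ℝ := {t | t₀ ≤ t ∧ (t : EReal) < T}

/-- The time interval `(t₀, T)`; here `T` may be `+∞`. -/
def timeOO (t₀ : ℝ) (T : EReal) : Set ℝ := {t | t₀ < t ∧ (t : EReal) < T}

/-- The smoothness asked of a velocity field: the field and its first space derivatives are
continuous on `[t₀, T) × closure Ω`; its second space derivatives and its time derivative are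
continuous on `(t₀, T) × closure Ω`; in the open domain, for `t > t₀`, it has three continuous
space derivatives, and the space derivatives of its time derivative are continuous. -/
structure VelocityRegular (Ω : C2Domain D) (t₀ : ℝ) (T : EReal) (v : ℝ → Euc D → Euc D) :
    Prop where
  contDiffOn_one : ∀ t ∈ timeCO t₀ T, ContDiffOn ℝ 1 (v t) Ω.cl
  cont : ContinuousOn (fun z : ℝ × Euc D => v z.1 z.2) (timeCO t₀ T ×ˢ Ω.cl)
  cont_pd : ∀ i, ContinuousOn (fun z : ℝ × Euc D => pd Ω i (v z.1) z.2) (timeCO t₀ T ×ˢ Ω.cl)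
  contDiffOn_two : ∀ t ∈ timeOO t₀ T, ContDiffOn ℝ 2 (v t) Ω.cl
  cont_pd_pd : ∀ i j, ContinuousOn (fun z : ℝ × Euc D => pd Ω i (pd Ω j (v z.1)) z.2)
    (timeOO t₀ T ×ˢ Ω.cl)
  differentiableAt_time : ∀ t ∈ timeOO t₀ T, ∀ x ∈ Ω.cl, DifferentiableAt ℝ (fun s => v s x) t
  cont_dt : ContinuousOn (fun z : ℝ × Euc D => dt v z.1 z.2) (timeOO t₀ T ×ˢ Ω.cl)
  contDiffOn_three : ∀ t ∈ timeOO t₀ T, ContDiffOn ℝ 3 (v t) Ω.carrier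
  contDiffOn_dt : ∀ t ∈ timeOO t₀ T, ContDiffOn ℝ 1 (dt v t) Ω.carrier
  cont_pd_dt : ∀ i, ContinuousOn (fun z : ℝ × Euc D => pd Ω i (dt v z.1) z.2)
    (timeOO t₀ T ×ˢ Ω.carrier)

/-- The smoothness asked of a pressure field: for each `t > t₀` it is `C¹` up to the boundary and
`C²` in the open domain. -/
structure PressureRegular (Ω : C2Domain D) (t₀ : ℝ) (T : EReal) (q : ℝ → Euc D → ℝ) :
    Prop where
  contDiffOn_one : ∀ t ∈ timeOO t₀ T, ContDiffOn ℝ 1 (q t) Ω.cl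
  contDiffOn_two : ∀ t ∈ timeOO t₀ T, ContDiffOn ℝ 2 (q t) Ω.carrier

/-- The smoothness asked of the external force: for each `t > t₀` it is continuous up to the
boundary and `C¹` in the open domain. -/
structure ForceRegular (Ω : C2Domain D) (t₀ : ℝ) (T : EReal) (g : ℝ → Euc D → Euc D) :
    Prop where
  cont : ∀ t ∈ timeOO t₀ T, ContinuousOn (g t) Ω.cl
  contDiffOn_one : ∀ t ∈ timeOO t₀ T, ContDiffOn ℝ 1 (g t) Ω.carrier

/-- The smoothness asked of the potential `φ` in a splitting `u = w + ∇φ`: it is `C¹` up to the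
boundary at each time, and `∂φ/∂t` and `∇ ∂φ/∂t` are continuous on `(t₀, T) × closure Ω`. -/
structure PotentialRegular (Ω : C2Domain D) (t₀ : ℝ) (T : EReal) (φ : ℝ → Euc D → ℝ) :
    Prop where
  contDiffOn_one : ∀ t ∈ timeCO t₀ T, ContDiffOn ℝ 1 (φ t) Ω.cl
  differentiableAt_time : ∀ t ∈ timeOO t₀ T, ∀ x ∈ Ω.cl, DifferentiableAt ℝ (fun s => φ s x) t
  cont_dt : ContinuousOn (fun z : ℝ × Euc D => dt φ z.1 z.2) (timeOO t₀ T ×ˢ Ω.cl)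
  contDiffOn_dt : ∀ t ∈ timeOO t₀ T, ContDiffOn ℝ 1 (dt φ t) Ω.cl
  cont_pd_dt : ∀ i, ContinuousOn (fun z : ℝ × Euc D => pd Ω i (dt φ z.1) z.2)
    (timeOO t₀ T ×ˢ Ω.cl)

/-- `(u, p)` is a classical solution on `[t₀, T)` of the incompressible Navier–Stokes equations
with no-slip conditions. -/
structure IsINSE (Ω : C2Domain D) (ν t₀ : ℝ) (T : EReal) (g : ℝ → Euc D → Euc D)
    (u : ℝ → Euc D → Euc D) (p : ℝ → Euc D → ℝ) : Prop where
  regular_u : VelocityRegular Ω t₀ T u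
  regular_p : PressureRegular Ω t₀ T p
  momentum : ∀ t ∈ timeOO t₀ T, ∀ x ∈ Ω.carrier,
    dt u t x + convect Ω (u t) x = g t x - grad Ω (p t) x + ν • lap Ω (u t) x
  solenoidal : ∀ t ∈ timeCO t₀ T, ∀ x ∈ Ω.carrier, dvg Ω (u t) x = 0
  no_slip : ∀ t ∈ timeCO t₀ T, ∀ x ∈ Ω.bd, u t x = 0

/-- `v` is the divergence-free part in the Helmholtz decomposition `w = v + ∇ψ` of `w`, with
prescribed normal component `b` of `v` on the boundary. -/
def IsHelmholtzPart (Ω : C2Domain D) (b : Euc D → ℝ) (w v : Euc D → Euc D) : Prop :=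
  (∃ ψ : Euc D → ℝ, ContDiffOn ℝ 1 ψ Ω.cl ∧ ContDiffOn ℝ 2 ψ Ω.carrier ∧
    ∀ x ∈ Ω.cl, w x = v x + grad Ω ψ x) ∧
  (∀ x ∈ Ω.carrier, dvg Ω v x = 0) ∧
  (∀ x ∈ Ω.bd, inner ℝ (v x) (Ω.normal x) = b x)

/-- `v = 𝒫w`, the Leray–Helmholtz projection of `w`: the divergence-free part of `w` that is
tangential on the boundary. -/
def IsLerayProjection (Ω : C2Domain D) (w v : Euc D → Euc D) : Prop :=
  IsHelmholtzPart Ω (fun _ => 0) w v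

/-- The electric boundary conditions `w · τ = 0` (for every tangent vector `τ`) and `∇ · w = 0`
on the boundary, at all times in `[t₀, T)`. -/
def ElectricBC (Ω : C2Domain D) (t₀ : ℝ) (T : EReal) (w : ℝ → Euc D → Euc D) : Prop :=
  ∀ t ∈ timeCO t₀ T, ∀ x ∈ Ω.bd,
    (∀ τ : Euc D, inner ℝ τ (Ω.normal x) = 0 → inner ℝ (w t x) τ = 0) ∧ dvg Ω (w t) x = 0

/-- The heat equation `∂(∇ · w)/∂t = ν Δ(∇ · w)` in the domain. -/
def DivergenceHeat (Ω : C2Domain D) (ν t₀ : ℝ) (T : EReal) (w : ℝ → Euc D → Euc D) : Prop :=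
  ∀ t ∈ timeOO t₀ T, ∀ x ∈ Ω.carrier,
    HasDerivAt (fun s => dvg Ω (w s) x) (ν * lap Ω (dvg Ω (w t)) x) t

/-- The decay law `∂(n · w)/∂t = -lam (n · w)` on the boundary. -/
def NormalDecay (Ω : C2Domain D) (lam t₀ : ℝ) (T : EReal) (w : ℝ → Euc D → Euc D) : Prop :=
  ∀ t ∈ timeOO t₀ T, ∀ x ∈ Ω.bd,
    HasDerivAt (fun s => (inner ℝ (Ω.normal x) (w s x) : ℝ))
      (-lam * inner ℝ (Ω.normal x) (w t x)) t

/-- `(w, u, q)` is a classical solution on `[t₀, T)` of the GePUP-E equations. The initial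
condition that links `w` to `u` is stated separately. -/
structure IsGePUPE (Ω : C2Domain D) (ν lam t₀ : ℝ) (T : EReal) (g : ℝ → Euc D → Euc D)
    (w u : ℝ → Euc D → Euc D) (q : ℝ → Euc D → ℝ) : Prop where
  regular_w : VelocityRegular Ω t₀ T w
  regular_u : VelocityRegular Ω t₀ T u
  regular_q : PressureRegular Ω t₀ T q
  momentum : ∀ t ∈ timeOO t₀ T, ∀ x ∈ Ω.carrier,
    dt w t x = g t x - convect Ω (u t) x - grad Ω (q t) x + ν • lap Ω (w t) x
  electric : ElectricBC Ω t₀ T w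
  projection : ∀ t ∈ timeCO t₀ T, IsLerayProjection Ω (w t) (u t)
  no_penetration : ∀ t ∈ timeCO t₀ T, ∀ x ∈ Ω.bd, inner ℝ (u t x) (Ω.normal x) = 0
  pressure_poisson : ∀ t ∈ timeOO t₀ T, ∀ x ∈ Ω.carrier,
    lap Ω (q t) x = dvg Ω (fun y => g t y - convect Ω (u t) y) x
  pressure_neumann : ∀ t ∈ timeOO t₀ T, ∀ x ∈ Ω.bd,
    (inner ℝ (Ω.normal x) (grad Ω (q t) x) : ℝ) =
      inner ℝ (Ω.normal x) (g t x - convect Ω (u t) x + ν • lap Ω (w t) x)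
        + lam * inner ℝ (Ω.normal x) (w t x)

/-- The initial condition `w(·, t₀) = u(·, t₀)` on the closed domain. -/
def SameInitial (Ω : C2Domain D) (t₀ : ℝ) (w u : ℝ → Euc D → Euc D) : Prop :=
  ∀ x ∈ Ω.cl, w t₀ x = u t₀ x

end GePUP

end

open scoped Topology

noncomputable section

namespace GePUP

variable {D : ℕ} {F : Type*} [NormedAddCommGroup F] [NormedSpace ℝ F]

/-! ### Geometry of the domain: the interior ball condition and unique differentiability. -/

section Domain

variable (Ω : C2Domain D)

/-! Write `d = ∇ · w`. In the divergence of the GePUP-E momentum equation, the Poisson equation for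
`q` cancels everything except `∂d/∂t = ν Δd`. In its normal trace on the boundary, the Neumann
condition for `q` leaves `∂(n · w)/∂t = -lam (n · w)`. Given the momentum equation, both
implications reverse, so the two pressure conditions amount to the two evolution laws
(`isGePUPE_of_momentum`).

With the initial condition, `d` and `n · w` vanish at `t₀`, and the electric conditions give `d = 0`
on the boundary. The weak maximum principle (`heat_eq_zero`) yields `d = 0`, and an integrating
factor yields `n · w = 0`. Then `w - u` is the gradient of a harmonic function with zero Neumann
data, which vanishes by the Hopf lemma and the strong maximum principle (`grad_eq_zero_of_neumann`).
Hence `w = u`; the momentum equation becomes Navier–Stokes, and the tangential and normal conditions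
together give no slip.

Conversely, for `w = u` both evolution laws are trivial. For a splitting `u = w + ∇φ`,
incompressibility gives `Δφ = -d`, so `ν Δ∇φ = -ν ∇d`, and every gradient is absorbed in `q = p +
∂φ/∂t + ν d`. The regularity of this `q` comes from `∇φ = u - w` and `∇ ∂φ/∂t = ∂u/∂t - ∂w/∂t`. -/

theorem C2Domain.carrier_subset_cl : Ω.carrier ⊆ Ω.cl := subset_closure

theorem C2Domain.bd_subset_cl : Ω.bd ⊆ Ω.cl := frontier_subset_closure

theorem C2Domain.isCompact_cl : IsCompact Ω.cl := Ω.isBounded.isCompact_closure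

theorem C2Domain.mem_or_mem_of_mem_cl {x : Euc D} (hx : x ∈ Ω.cl) : x ∈ Ω.carrier ∨ x ∈ Ω.bd := by
  by_cases h : x ∈ Ω.carrier
  · exact Or.inl h
  · exact Or.inr ⟨hx, by rwa [Ω.isOpen.interior_eq]⟩

theorem C2Domain.cl_mem_nhds {x : Euc D} (hx : x ∈ Ω.carrier) : Ω.cl ∈ 𝓝 x :=
  Filter.mem_of_superset (Ω.isOpen.mem_nhds hx) Ω.carrier_subset_cl

theorem C2Domain.norm_normal {x : Euc D} (hx : x ∈ Ω.bd) : ‖Ω.normal x‖ = 1 :=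
  norm_smul_inv_norm (𝕜 := ℝ) (Ω.gradient_ne_zero x hx)

/-- Two functions continuous on the closed domain that agree inside agree up to the boundary. -/
theorem C2Domain.eqOn_cl {E : Type*} [TopologicalSpace E] [T2Space E] {f g : Euc D → E}
    (hf : ContinuousOn f Ω.cl) (hg : ContinuousOn g Ω.cl)
    (h : EqOn f g Ω.carrier) : EqOn f g Ω.cl :=
  h.of_subset_closure hf hg Ω.carrier_subset_cl subset_rfl

/-- A function of class `C²` lies below its quadratic Taylor bound near each point. -/
theorem exists_le_quadratic {ρ : Euc D → ℝ} (hρ : ContDiff ℝ 2 ρ) (x : Euc D) :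
    ∃ K > 0, ∃ δ > 0, ∀ y ∈ Metric.ball x δ,
      ρ y ≤ ρ x + inner ℝ (gradient ρ x) (y - x) + K * ‖y - x‖ ^ 2 := by
  obtain ⟨K, s, hs, hK⟩ := ((hρ.fderiv_right (m := 1) (by norm_num)).contDiffAt
    (x := x)).exists_lipschitzOnWith
  obtain ⟨δ, hδ, hδs⟩ := Metric.mem_nhds_iff.1 hs
  -- `K` is a local Lipschitz constant of the derivative and may be zero; adding one makes it
  -- positive.
  refine ⟨K + 1, by positivity, δ, hδ, fun y hy => ?_⟩
  have hd : Differentiable ℝ ρ := hρ.differentiable (by norm_num)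
  have hxy : segment ℝ x y ⊆ Metric.ball x δ :=
    (convex_ball x δ).segment_subset (Metric.mem_ball_self hδ) hy
  have key : ‖ρ y - ρ x - fderiv ℝ ρ x (y - x)‖ ≤ (K * ‖y - x‖) * ‖y - x‖ := by
    refine Convex.norm_image_sub_le_of_norm_hasFDerivWithin_le'
      (f' := fun z => fderiv ℝ ρ z) (s := segment ℝ x y)
      (fun z _ => (hd z).hasFDerivAt.hasFDerivWithinAt) (fun z hz => ?_) (convex_segment x y)
      (left_mem_segment ℝ x y) (right_mem_segment ℝ x y)
    have h1 := hK.dist_le_mul z (hδs (hxy hz)) x (hδs (Metric.mem_ball_self hδ))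
    rw [dist_eq_norm, dist_eq_norm] at h1
    refine h1.trans (mul_le_mul_of_nonneg_left ?_ K.coe_nonneg)
    obtain ⟨a, ha, rfl⟩ := (segment_eq_image' ℝ x y ▸ hz :)
    simp only [add_sub_cancel_left, norm_smul, Real.norm_eq_abs, abs_of_nonneg ha.1]
    exact mul_le_of_le_one_left (norm_nonneg _) ha.2
  have hg : inner ℝ (gradient ρ x) (y - x) = fderiv ℝ ρ x (y - x) := by
    simp [gradient]
  rw [hg]
  have := (abs_le.1 key).2
  nlinarith [sq_nonneg ‖y - x‖]

/-- The interior ball condition. -/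
theorem C2Domain.exists_ball_subset {x : Euc D} (hx : x ∈ Ω.bd) :
    ∃ r > 0, Metric.ball (x - r • Ω.normal x) r ⊆ Ω.carrier := by
  obtain ⟨K, hK, δ, hδ, hq⟩ := exists_le_quadratic Ω.contDiff_ρ x
  have hρx : Ω.ρ x = 0 := by
    have : x ∈ {x | Ω.ρ x = 0} := Ω.frontier_eq ▸ hx
    exact this
  set G := gradient Ω.ρ x with hG
  have hGp : 0 < ‖G‖ := norm_pos_iff.2 (Ω.gradient_ne_zero x hx)
  have hGn : G = ‖G‖ • Ω.normal x := by
    rw [C2Domain.normal, smul_smul, mul_inv_cancel₀ hGp.ne', one_smul]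
  set n := Ω.normal x with hn
  have hn1 : ‖n‖ = 1 := Ω.norm_normal hx
  -- The first bound keeps the ball inside the Taylor neighbourhood; the second makes the quadratic
  -- term at most half the linear one.
  refine ⟨min (δ / 2) (‖G‖ / (4 * K)), by positivity, fun y hy => ?_⟩
  set r := min (δ / 2) (‖G‖ / (4 * K)) with hr
  have hr0 : 0 < r := by positivity
  have hr1 : r ≤ δ / 2 := min_le_left _ _
  have hr2 : r * (4 * K) ≤ ‖G‖ := by
    have := min_le_right (δ / 2) (‖G‖ / (4 * K))
    rwa [← hr, le_div_iff₀ (by positivity)] at this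
  rw [mem_ball_iff_norm] at hy
  have e1 : y - (x - r • n) = (y - x) + r • n := by abel
  rw [e1] at hy
  have h2 : ‖(y - x) + r • n‖ ^ 2 < r ^ 2 := by gcongr
  rw [norm_add_sq_real, norm_smul, hn1, inner_smul_right, Real.norm_eq_abs, abs_of_pos hr0] at h2
  have hyx : ‖y - x‖ < δ := by
    have : ‖y - x‖ ≤ ‖(y - x) + r • n‖ + ‖r • n‖ := by
      simpa using norm_sub_le ((y - x) + r • n) (r • n)
    rw [norm_smul, hn1, Real.norm_eq_abs, abs_of_pos hr0] at this
    linarith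
  have h3 := hq y (mem_ball_iff_norm.2 hyx)
  rw [hGn, hρx, inner_smul_left, real_inner_comm] at h3
  simp only [conj_trivial] at h3
  rw [Ω.carrier_eq, mem_ofPred_eq]
  set I := inner ℝ (y - x) n
  -- Expanding the square in `h2` gives `‖y - x‖² < -2 r I`.
  have hI : I < 0 := by nlinarith [sq_nonneg ‖y - x‖]
  have h4 : K * ‖y - x‖ ^ 2 ≤ K * (2 * r * -I) := by
    apply mul_le_mul_of_nonneg_left _ hK.le; nlinarith
  have h5 : r * (4 * K) * -I ≤ ‖G‖ * -I := mul_le_mul_of_nonneg_right hr2 (by linarith)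
  nlinarith [mul_pos hGp (neg_pos.2 hI)]

/-- At a boundary point the closure contains a closed ball through it, which is convex with nonempty
interior. This makes the one-sided derivatives in `pd` unique, so the calculus rules hold up to the
boundary. -/
theorem C2Domain.uniqueDiffOn_cl : UniqueDiffOn ℝ Ω.cl := by
  intro x hx
  rcases Ω.mem_or_mem_of_mem_cl hx with h | h
  · exact (uniqueDiffWithinAt_of_mem_nhds (Ω.cl_mem_nhds h))
  · obtain ⟨r, hr, hb⟩ := Ω.exists_ball_subset h
    have hc : closure (Metric.ball (x - r • Ω.normal x) r) ⊆ Ω.cl := closure_mono hb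
    rw [closure_ball _ hr.ne'] at hc
    refine UniqueDiffWithinAt.mono (uniqueDiffWithinAt_convex (convex_closedBall _ r) ?_ ?_) hc
    · exact ⟨_, Metric.ball_subset_interior_closedBall (Metric.mem_ball_self hr)⟩
    · apply subset_closure
      simp [norm_smul, Ω.norm_normal h, abs_of_pos hr]

end Domain

/-! ### Calculus of `pd`, `grad`, `dvg` and `lap` on the closed domain. -/

section Calculus

variable {Ω : C2Domain D} {i j : Fin D} {f g : Euc D → F} {x : Euc D}

theorem pd_of_mem (hx : x ∈ Ω.carrier) :
    pd Ω i f x = fderiv ℝ f x (EuclideanSpace.single i 1) := by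
  rw [pd, fderivWithin_of_mem_nhds (Ω.cl_mem_nhds hx)]

theorem pd_congr_cl (h : EqOn f g Ω.cl) : EqOn (pd Ω i f) (pd Ω i g) Ω.cl := fun y hy => by
  rw [pd, pd, fderivWithin_congr h (h hy)]

theorem pd_congr_carrier (h : EqOn f g Ω.carrier) :
    EqOn (pd Ω i f) (pd Ω i g) Ω.carrier := fun y hy => by
  rw [pd_of_mem hy, pd_of_mem hy, (h.eventuallyEq_of_mem (Ω.isOpen.mem_nhds hy)).fderiv_eq]

theorem pd_add (hx : x ∈ Ω.cl) (hf : DifferentiableWithinAt ℝ f Ω.cl x)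
    (hg : DifferentiableWithinAt ℝ g Ω.cl x) :
    pd Ω i (fun y => f y + g y) x = pd Ω i f x + pd Ω i g x := by
  simp [pd, fderivWithin_fun_add (Ω.uniqueDiffOn_cl x hx) hf hg]

theorem pd_sub (hx : x ∈ Ω.cl) (hf : DifferentiableWithinAt ℝ f Ω.cl x)
    (hg : DifferentiableWithinAt ℝ g Ω.cl x) :
    pd Ω i (fun y => f y - g y) x = pd Ω i f x - pd Ω i g x := by
  simp [pd, fderivWithin_fun_sub (Ω.uniqueDiffOn_cl x hx) hf hg]

theorem pd_neg (hx : x ∈ Ω.cl) : pd Ω i (fun y => -f y) x = -pd Ω i f x := by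
  simp [pd, fderivWithin_fun_neg (Ω.uniqueDiffOn_cl x hx)]

theorem pd_const_smul (c : ℝ) (hx : x ∈ Ω.cl) (hf : DifferentiableWithinAt ℝ f Ω.cl x) :
    pd Ω i (fun y => c • f y) x = c • pd Ω i f x := by
  simp [pd, fderivWithin_fun_const_smul (Ω.uniqueDiffOn_cl x hx) hf]

theorem pd_sum {ι : Type*} (s : Finset ι) {f : ι → Euc D → F} (hx : x ∈ Ω.cl)
    (hf : ∀ k ∈ s, DifferentiableWithinAt ℝ (f k) Ω.cl x) :
    pd Ω i (fun y => ∑ k ∈ s, f k y) x = ∑ k ∈ s, pd Ω i (f k) x := by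
  simp [pd, fderivWithin_fun_sum (Ω.uniqueDiffOn_cl x hx) hf]

/-- Partial derivatives of a vector field are taken componentwise. -/
theorem pd_apply {v : Euc D → Euc D} (hx : x ∈ Ω.cl) (hv : DifferentiableWithinAt ℝ v Ω.cl x) :
    pd Ω i (fun y => v y j) x = pd Ω i v x j := by
  have h := (EuclideanSpace.proj (𝕜 := ℝ) j).hasFDerivAt.comp_hasFDerivWithinAt x
    hv.hasFDerivWithinAt
  have h2 := h.fderivWithin (Ω.uniqueDiffOn_cl x hx)
  have h3 : pd Ω i (fun y => v y j) x
    = fderivWithin ℝ (⇑(EuclideanSpace.proj (𝕜 := ℝ) j) ∘ v) Ω.cl x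
      (EuclideanSpace.single i 1) := rfl
  rw [h3, h2]; rfl

theorem contDiffOn_pd_cl {m n : ℕ} (hf : ContDiffOn ℝ n f Ω.cl) (h : m + 1 ≤ n) :
    ContDiffOn ℝ m (pd Ω i f) Ω.cl :=
  (hf.fderivWithin Ω.uniqueDiffOn_cl (m := m) (by exact_mod_cast h)).clm_apply contDiffOn_const

theorem contDiffOn_pd_carrier {m n : ℕ} (hf : ContDiffOn ℝ n f Ω.carrier) (h : m + 1 ≤ n) :
    ContDiffOn ℝ m (pd Ω i f) Ω.carrier :=
  ((hf.fderiv_of_isOpen Ω.isOpen (m := m) (by exact_mod_cast h)).clm_apply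
    contDiffOn_const).congr fun _ hy => pd_of_mem hy

theorem differentiableAt_of_contDiffOn {n : ℕ} (hn : n ≠ 0) (hf : ContDiffOn ℝ n f Ω.carrier)
    (hx : x ∈ Ω.carrier) : DifferentiableAt ℝ f x :=
  (hf.contDiffAt (Ω.isOpen.mem_nhds hx)).differentiableAt (by exact_mod_cast hn)

theorem differentiableWithinAt_of_contDiffOn {n : ℕ} (hn : n ≠ 0)
    (hf : ContDiffOn ℝ n f Ω.carrier) (hx : x ∈ Ω.carrier) : DifferentiableWithinAt ℝ f Ω.cl x :=
  (differentiableAt_of_contDiffOn hn hf hx).differentiableWithinAt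

theorem pd_comm (hf : ContDiffOn ℝ 2 f Ω.carrier) (hx : x ∈ Ω.carrier) :
    pd Ω i (pd Ω j f) x = pd Ω j (pd Ω i f) x := by
  have hfx := hf.contDiffAt (Ω.isOpen.mem_nhds hx)
  have hd : DifferentiableAt ℝ (fderiv ℝ f) x :=
    (hfx.fderiv_right (m := 1) (by norm_num)).differentiableAt (by norm_num)
  have key : ∀ k l : Fin D, pd Ω k (pd Ω l f) x
      = fderiv ℝ (fderiv ℝ f) x (EuclideanSpace.single k 1) (EuclideanSpace.single l 1) := by
    intro k l
    rw [pd_of_mem hx, Filter.EventuallyEq.fderiv_eq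
      (Filter.eventuallyEq_of_mem (Ω.isOpen.mem_nhds hx) fun y hy => pd_of_mem hy),
      fderiv_clm_apply hd (by fun_prop)]
    simp
  rw [key, key]
  exact hfx.isSymmSndFDerivAt (by simp) _ _

theorem contDiffOn_apply_euc {n : ℕ} {s : Set (Euc D)} {v : Euc D → Euc D}
    (hv : ContDiffOn ℝ n v s) (i : Fin D) : ContDiffOn ℝ n (fun y => v y i) s :=
  contDiffOn_euclidean.1 hv i

theorem contDiffOn_grad_cl {m n : ℕ} {q : Euc D → ℝ} (hq : ContDiffOn ℝ n q Ω.cl)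
    (h : m + 1 ≤ n) : ContDiffOn ℝ m (grad Ω q) Ω.cl :=
  contDiffOn_euclidean.2 fun _ => contDiffOn_pd_cl hq h

theorem contDiffOn_grad_carrier {m n : ℕ} {q : Euc D → ℝ} (hq : ContDiffOn ℝ n q Ω.carrier)
    (h : m + 1 ≤ n) : ContDiffOn ℝ m (grad Ω q) Ω.carrier :=
  contDiffOn_euclidean.2 fun _ => contDiffOn_pd_carrier hq h

theorem contDiffOn_dvg_cl {m n : ℕ} {v : Euc D → Euc D} (hv : ContDiffOn ℝ n v Ω.cl)
    (h : m + 1 ≤ n) : ContDiffOn ℝ m (dvg Ω v) Ω.cl :=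
  ContDiffOn.sum fun i _ => contDiffOn_apply_euc (contDiffOn_pd_cl hv h) i

theorem contDiffOn_dvg_carrier {m n : ℕ} {v : Euc D → Euc D} (hv : ContDiffOn ℝ n v Ω.carrier)
    (h : m + 1 ≤ n) : ContDiffOn ℝ m (dvg Ω v) Ω.carrier :=
  ContDiffOn.sum fun i _ => contDiffOn_apply_euc (contDiffOn_pd_carrier hv h) i

theorem contDiffOn_lap_cl {m n : ℕ} (hf : ContDiffOn ℝ n f Ω.cl)
    (h : m + 2 ≤ n) : ContDiffOn ℝ m (lap Ω f) Ω.cl :=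
  ContDiffOn.sum fun _ _ =>
    contDiffOn_pd_cl (contDiffOn_pd_cl hf (m := m + 1) (by omega)) le_rfl

theorem contDiffOn_lap_carrier {m n : ℕ} (hf : ContDiffOn ℝ n f Ω.carrier)
    (h : m + 2 ≤ n) : ContDiffOn ℝ m (lap Ω f) Ω.carrier :=
  ContDiffOn.sum fun _ _ =>
    contDiffOn_pd_carrier (contDiffOn_pd_carrier hf (m := m + 1) (by omega)) le_rfl

theorem contDiffOn_convect {m n : ℕ} {v : Euc D → Euc D} (hv : ContDiffOn ℝ n v Ω.cl)
    (h : m + 1 ≤ n) : ContDiffOn ℝ m (convect Ω v) Ω.cl :=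
  ContDiffOn.sum fun i _ =>
    ((contDiffOn_apply_euc hv i).of_le (by exact_mod_cast (by omega : m ≤ n))).smul
      (contDiffOn_pd_cl hv h)

theorem lap_congr_cl (h : EqOn f g Ω.cl) : EqOn (lap Ω f) (lap Ω g) Ω.cl := fun _ hy =>
  Finset.sum_congr rfl fun _ _ => pd_congr_cl (pd_congr_cl h) hy

theorem lap_congr_carrier (h : EqOn f g Ω.carrier) :
    EqOn (lap Ω f) (lap Ω g) Ω.carrier := fun _ hy =>
  Finset.sum_congr rfl fun _ _ => pd_congr_carrier (pd_congr_carrier h) hy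

theorem dvg_congr_carrier {v w : Euc D → Euc D} (h : EqOn v w Ω.carrier) :
    EqOn (dvg Ω v) (dvg Ω w) Ω.carrier := fun _ hy =>
  Finset.sum_congr rfl fun _ _ => by rw [pd_congr_carrier h hy]

theorem dvg_congr_cl {v w : Euc D → Euc D} (h : EqOn v w Ω.cl) :
    EqOn (dvg Ω v) (dvg Ω w) Ω.cl := fun _ hy =>
  Finset.sum_congr rfl fun _ _ => by rw [pd_congr_cl h hy]

theorem lap_add (hf : ContDiffOn ℝ 2 f Ω.carrier) (hg : ContDiffOn ℝ 2 g Ω.carrier)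
    (hx : x ∈ Ω.carrier) : lap Ω (fun y => f y + g y) x = lap Ω f x + lap Ω g x := by
  simp only [lap, ← Finset.sum_add_distrib]
  refine Finset.sum_congr rfl fun i _ => ?_
  have h : EqOn (pd Ω i (fun y => f y + g y)) (fun y => pd Ω i f y + pd Ω i g y) Ω.carrier :=
    fun y hy => pd_add (Ω.carrier_subset_cl hy)
      (differentiableWithinAt_of_contDiffOn two_ne_zero hf hy)
      (differentiableWithinAt_of_contDiffOn two_ne_zero hg hy)
  rw [pd_congr_carrier h hx]
  exact pd_add (Ω.carrier_subset_cl hx)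
    (differentiableWithinAt_of_contDiffOn one_ne_zero (contDiffOn_pd_carrier hf (m := 1) le_rfl) hx)
    (differentiableWithinAt_of_contDiffOn one_ne_zero (contDiffOn_pd_carrier hg (m := 1) le_rfl) hx)

theorem dvg_add {v w : Euc D → Euc D} (hx : x ∈ Ω.cl) (hv : DifferentiableWithinAt ℝ v Ω.cl x)
    (hw : DifferentiableWithinAt ℝ w Ω.cl x) :
    dvg Ω (fun y => v y + w y) x = dvg Ω v x + dvg Ω w x := by
  simp [dvg, pd_add hx hv hw, Finset.sum_add_distrib]

theorem dvg_sub {v w : Euc D → Euc D} (hx : x ∈ Ω.cl) (hv : DifferentiableWithinAt ℝ v Ω.cl x)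
    (hw : DifferentiableWithinAt ℝ w Ω.cl x) :
    dvg Ω (fun y => v y - w y) x = dvg Ω v x - dvg Ω w x := by
  simp [dvg, pd_sub hx hv hw, Finset.sum_sub_distrib]

theorem dvg_const_smul {v : Euc D → Euc D} (c : ℝ) (hx : x ∈ Ω.cl)
    (hv : DifferentiableWithinAt ℝ v Ω.cl x) :
    dvg Ω (fun y => c • v y) x = c * dvg Ω v x := by
  simp [dvg, pd_const_smul c hx hv, Finset.mul_sum]

theorem dvg_grad {q : Euc D → ℝ} (hq : ContDiffOn ℝ 2 q Ω.carrier) (hx : x ∈ Ω.carrier) :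
    dvg Ω (grad Ω q) x = lap Ω q x :=
  Finset.sum_congr rfl fun _ _ => (pd_apply (Ω.carrier_subset_cl hx)
    (differentiableWithinAt_of_contDiffOn one_ne_zero
      (contDiffOn_grad_carrier hq (m := 1) le_rfl) hx)).symm

/-- The divergence commutes with partial derivatives. -/
theorem pd_dvg {v : Euc D → Euc D} (hv : ContDiffOn ℝ 2 v Ω.carrier) (hx : x ∈ Ω.carrier) :
    pd Ω j (dvg Ω v) x = dvg Ω (pd Ω j v) x := by
  have h1 : ∀ i, ContDiffOn ℝ 1 (pd Ω i v) Ω.carrier := fun i =>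
    contDiffOn_pd_carrier hv (m := 1) le_rfl
  have h2 : pd Ω j (dvg Ω v) x = ∑ i, pd Ω j (fun y => pd Ω i v y i) x :=
    pd_sum _ (Ω.carrier_subset_cl hx) fun i _ => differentiableWithinAt_of_contDiffOn one_ne_zero
      (contDiffOn_apply_euc (h1 i) i) hx
  rw [h2]
  refine Finset.sum_congr rfl fun i _ => ?_
  rw [pd_apply (Ω.carrier_subset_cl hx) (differentiableWithinAt_of_contDiffOn one_ne_zero (h1 i) hx),
    pd_comm hv hx]

theorem dvg_lap {v : Euc D → Euc D} (hv : ContDiffOn ℝ 3 v Ω.carrier) (hx : x ∈ Ω.carrier) :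
    dvg Ω (lap Ω v) x = lap Ω (dvg Ω v) x := by
  have h2 : ∀ i, ContDiffOn ℝ 2 (pd Ω i v) Ω.carrier := fun i =>
    contDiffOn_pd_carrier hv (m := 2) le_rfl
  have h1 : ∀ i, ContDiffOn ℝ 1 (pd Ω i (pd Ω i v)) Ω.carrier := fun i =>
    contDiffOn_pd_carrier (h2 i) (m := 1) le_rfl
  have e : ∀ i, pd Ω i (lap Ω v) x = ∑ j, pd Ω i (pd Ω j (pd Ω j v)) x := fun i =>
    pd_sum _ (Ω.carrier_subset_cl hx) fun j _ =>
      differentiableWithinAt_of_contDiffOn one_ne_zero (h1 j) hx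
  have hv2 : ContDiffOn ℝ 2 v Ω.carrier := hv.of_le (by norm_num)
  have e2 : ∀ j, pd Ω j (pd Ω j (dvg Ω v)) x = ∑ i, pd Ω i (pd Ω j (pd Ω j v)) x i := fun j => by
    rw [pd_congr_carrier (fun y hy => pd_dvg hv2 hy) hx, pd_dvg (h2 j) hx]; rfl
  simp only [lap, e2]
  rw [Finset.sum_comm]
  refine Finset.sum_congr rfl fun i _ => ?_
  simp [e i]

/-- Links the radial derivative in the Hopf lemma to the Neumann data `n · ∇ψ`. -/
theorem fderivWithin_eq_inner_grad {q : Euc D → ℝ} (n : Euc D) :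
    fderivWithin ℝ q Ω.cl x n = inner ℝ n (grad Ω q x) := by
  conv_lhs => rw [← (EuclideanSpace.basisFun (Fin D) ℝ).sum_repr n]
  simp [PiLp.inner_apply, grad, pd, mul_comm]

/-- A function with partial derivatives of class `C^m` is of class `C^{m+1}`. -/
theorem contDiffOn_succ_of_grad {m : ℕ} {q : Euc D → ℝ} (hq : ContDiffOn ℝ 1 q Ω.carrier)
    (hg : ContDiffOn ℝ m (grad Ω q) Ω.carrier) : ContDiffOn ℝ (m + 1 : ℕ) q Ω.carrier := by
  push_cast
  rw [contDiffOn_succ_iff_fderiv_of_isOpen Ω.isOpen]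
  refine ⟨hq.differentiableOn (by norm_num), by simp, ?_⟩
  rw [contDiffOn_clm_apply]
  intro n
  have : ContDiffOn ℝ m (fun y => inner ℝ n (grad Ω q y)) Ω.carrier := contDiffOn_const.inner ℝ hg
  refine this.congr fun y hy => ?_
  rw [← fderivWithin_eq_inner_grad, fderivWithin_of_mem_nhds (Ω.cl_mem_nhds hy)]

end Calculus

/-! ### Time intervals and the exchange of time and space derivatives. -/

section Time

variable {t₀ : ℝ} {T : EReal}

theorem timeOO_subset_timeCO : timeOO t₀ T ⊆ timeCO t₀ T := fun _ ht => ⟨ht.1.le, ht.2⟩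

theorem isOpen_timeOO : IsOpen (timeOO t₀ T) :=
  (isOpen_lt continuous_const continuous_id).inter
    (isOpen_lt continuous_coe_real_ereal continuous_const)

theorem Icc_subset_timeCO {t : ℝ} (ht : t ∈ timeCO t₀ T) : Icc t₀ t ⊆ timeCO t₀ T := fun _ hs =>
  ⟨hs.1, (EReal.coe_le_coe_iff.2 hs.2).trans_lt ht.2⟩

theorem mem_timeOO_of_ne {t : ℝ} (ht : t ∈ timeCO t₀ T) (h : t ≠ t₀) : t ∈ timeOO t₀ T :=
  ⟨lt_of_le_of_ne ht.1 h.symm, ht.2⟩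

theorem left_mem_timeCO (hT : (t₀ : EReal) < T) : t₀ ∈ timeCO t₀ T := ⟨le_rfl, hT⟩

/-- Interchange of two derivatives of `f : ℝ → ℝ → F`, when one of the two mixed derivatives
exists and is continuous. -/
theorem hasDerivAt_swap {f fs fsh : ℝ → ℝ → F} {fh : ℝ → F} {t : ℝ}
    (h1 : ∀ᶠ z in 𝓝 (t, (0 : ℝ)), HasDerivAt (fun s => f s z.2) (fs z.1 z.2) z.1)
    (h2 : ∀ᶠ z in 𝓝 (t, (0 : ℝ)), HasDerivAt (fs z.1) (fsh z.1 z.2) z.2)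
    (h3 : ContinuousAt (fun z : ℝ × ℝ => fsh z.1 z.2) (t, 0))
    (h4 : ∀ᶠ s in 𝓝 t, HasDerivAt (f s) (fh s) 0) :
    HasDerivAt fh (fsh t 0) t := by
  set l := fsh t 0 with hl
  rw [hasDerivAt_iff_isLittleO, Asymptotics.isLittleO_iff]
  intro ε hε
  have h3' : ∀ᶠ z in 𝓝 (t, (0 : ℝ)), ‖fsh z.1 z.2 - l‖ < ε := by
    have := Metric.tendsto_nhds.1 h3.tendsto ε hε
    simpa [dist_eq_norm, hl] using this
  obtain ⟨δ, hδ, hb⟩ := Metric.eventually_nhds_iff_ball.1 (h1.and (h2.and h3'))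
  have hmem : ∀ s h : ℝ, |s - t| < δ → |h| < δ → (s, h) ∈ Metric.ball (t, (0 : ℝ)) δ := by
    intro s h hs hh
    rw [Metric.mem_ball, Prod.dist_eq, max_lt_iff]
    simpa [Real.dist_eq] using ⟨hs, hh⟩
  filter_upwards [h4, Metric.ball_mem_nhds t hδ] with s hs4 hsδ
  have h4t := h4.self_of_nhds
  rw [Metric.mem_ball, Real.dist_eq] at hsδ
  -- increments in `h` of the time increment are controlled
  have key : ∀ h : ℝ, |h| < δ →
      ‖(f s h - f t h - ((s - t) * h) • l) - (f s 0 - f t 0)‖ ≤ ε * |h| * |s - t| := by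
    intro h hh
    -- Mean value inequality in `h`, using that `fsh` is within `ε` of `l`; a second one in the time
    -- variable then bounds the double increment of `f`.
    have hA : ∀ σ : ℝ, |σ - t| < δ → ‖fs σ h - fs σ 0 - h • l‖ ≤ ε * |h| := by
      intro σ hσ
      have := Convex.norm_image_sub_le_of_norm_hasDerivWithin_le (𝕜 := ℝ)
        (f := fun k => fs σ k - k • l) (f' := fun k => fsh σ k - l) (C := ε)
        (s := Metric.ball (0 : ℝ) δ) (x := 0) (y := h)
        (fun k hk => by
          have hk' : |k| < δ := by simpa using hk
          have e := (hb _ (hmem σ k hσ hk')).2.1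
          have e2 := e.fun_sub ((hasDerivAt_id k).smul_const l)
          simpa using e2.hasDerivWithinAt)
        (fun k hk => by
          have hk' : |k| < δ := by simpa using hk
          exact (hb _ (hmem σ k hσ hk')).2.2.le)
        (convex_ball _ _) (Metric.mem_ball_self hδ) (by simpa using hh)
      have e3 : fs σ h - fs σ 0 - h • l = fs σ h - h • l - (fs σ 0 - (0 : ℝ) • l) := by
        simp; abel
      rw [e3]
      simpa using this
    have := Convex.norm_image_sub_le_of_norm_hasDerivWithin_le (𝕜 := ℝ)
        (f := fun σ => f σ h - f σ 0 - σ • (h • l)) (f' := fun σ => fs σ h - fs σ 0 - h • l)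
        (C := ε * |h|) (s := Metric.ball t δ) (x := t) (y := s)
        (fun σ hσ => by
          rw [Metric.mem_ball, Real.dist_eq] at hσ
          have e := (hb _ (hmem σ h hσ hh)).1
          have e0 := (hb _ (hmem σ 0 hσ (by simpa using hδ))).1
          have e2 := (e.fun_sub e0).fun_sub ((hasDerivAt_id σ).smul_const (h • l))
          simpa using e2.hasDerivWithinAt)
        (fun σ hσ => by
          rw [Metric.mem_ball, Real.dist_eq] at hσ
          exact hA σ hσ)
        (convex_ball _ _) (Metric.mem_ball_self hδ) (by simpa [Real.dist_eq] using hsδ)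
    have e3 : (f s h - f t h - ((s - t) * h) • l) - (f s 0 - f t 0)
        = f s h - f s 0 - s • (h • l) - (f t h - f t 0 - t • (h • l)) := by
      rw [mul_smul, sub_smul]; abel
    rw [e3]
    simpa using this
  have hder : HasDerivAt (fun h => f s h - f t h - ((s - t) * h) • l)
      (fh s - fh t - (s - t) • l) 0 := by
    have := (hs4.fun_sub h4t).fun_sub (((hasDerivAt_id (0 : ℝ)).const_mul (s - t)).smul_const l)
    simpa using this
  -- Letting `h → 0`: the estimate `key` is a Lipschitz bound at `h = 0`, hence bounds the
  -- derivative there.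
  have := hder.le_of_lip' (C := ε * |s - t|) (by positivity) (by
    filter_upwards [Metric.ball_mem_nhds (0 : ℝ) hδ] with h hh
    have := key h (by simpa using hh)
    simp only [mul_zero, zero_smul, sub_zero]
    calc _ ≤ _ := this
      _ = ε * |s - t| * ‖h‖ := by rw [Real.norm_eq_abs]; ring)
  simpa using this

/-- Time and space derivatives commute. -/
theorem hasDerivAt_pd {Ω : C2Domain D} {i : Fin D} {f : ℝ → Euc D → F}
    (hf : ∀ t ∈ timeOO t₀ T, ContDiffOn ℝ 1 (f t) Ω.carrier)
    (hd : ∀ t ∈ timeOO t₀ T, ∀ x ∈ Ω.carrier, DifferentiableAt ℝ (fun s => f s x) t)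
    (hdt : ∀ t ∈ timeOO t₀ T, ContDiffOn ℝ 1 (dt f t) Ω.carrier)
    (hc : ContinuousOn (fun z : ℝ × Euc D => pd Ω i (dt f z.1) z.2) (timeOO t₀ T ×ˢ Ω.carrier))
    {t : ℝ} (ht : t ∈ timeOO t₀ T) {x : Euc D} (hx : x ∈ Ω.carrier) :
    HasDerivAt (fun s => pd Ω i (f s) x) (pd Ω i (dt f t) x) t := by
  -- Restriction to the line through `x` in direction `e` reduces the claim to two real variables.
  set e : Euc D := EuclideanSpace.single i 1 with he
  have hline : ∀ h : ℝ, HasDerivAt (fun h : ℝ => x + h • e) e h := fun h => by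
    simpa using ((hasDerivAt_id h).smul_const e).const_add x
  have hcont : Continuous fun z : ℝ × ℝ => (z.1, x + z.2 • e) := by fun_prop
  have hopen : timeOO t₀ T ×ˢ Ω.carrier ∈ 𝓝 (t, x + (0 : ℝ) • e) := by
    apply (isOpen_timeOO.prod Ω.isOpen).mem_nhds
    simpa using ⟨ht, hx⟩
  have hev : ∀ᶠ z : ℝ × ℝ in 𝓝 (t, 0), z.1 ∈ timeOO t₀ T ∧ x + z.2 • e ∈ Ω.carrier :=
    (hcont.continuousAt (x := (t, 0))).preimage_mem_nhds hopen
  have hpd : ∀ (g : Euc D → F), ContDiffOn ℝ 1 g Ω.carrier → ∀ h : ℝ, x + h • e ∈ Ω.carrier →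
      HasDerivAt (fun h : ℝ => g (x + h • e)) (pd Ω i g (x + h • e)) h := fun g hg h hh => by
    rw [pd_of_mem hh]
    exact (differentiableAt_of_contDiffOn one_ne_zero hg hh).hasFDerivAt.comp_hasDerivAt h
      (hline h)
  have key := hasDerivAt_swap (f := fun s h => f s (x + h • e))
    (fs := fun s h => dt f s (x + h • e)) (fsh := fun s h => pd Ω i (dt f s) (x + h • e))
    (fh := fun s => pd Ω i (f s) (x + (0 : ℝ) • e)) (t := t)
    (hev.mono fun z hz => (hd _ hz.1 _ hz.2).hasDerivAt)
    (hev.mono fun z hz => hpd _ (hdt _ hz.1) _ hz.2)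
    ((hc.continuousAt hopen).comp_of_eq hcont.continuousAt rfl)
    (by
      filter_upwards [isOpen_timeOO.mem_nhds ht] with s hs
      exact hpd _ (hf s hs) 0 (by simpa using hx))
  simpa using key

namespace VelocityRegular

variable {Ω : C2Domain D} {w : ℝ → Euc D → Euc D}

theorem hasDerivAt_pd (hw : VelocityRegular Ω t₀ T w) (i : Fin D) {t : ℝ} (ht : t ∈ timeOO t₀ T)
    {x : Euc D} (hx : x ∈ Ω.carrier) :
    HasDerivAt (fun s => pd Ω i (w s) x) (pd Ω i (dt w t) x) t :=
  GePUP.hasDerivAt_pd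
    (fun s hs => (hw.contDiffOn_three s hs).of_le (by norm_num))
    (fun s hs y hy => hw.differentiableAt_time s hs y (Ω.carrier_subset_cl hy))
    hw.contDiffOn_dt (hw.cont_pd_dt i) ht hx

theorem hasDerivAt_dvg (hw : VelocityRegular Ω t₀ T w) {t : ℝ} (ht : t ∈ timeOO t₀ T)
    {x : Euc D} (hx : x ∈ Ω.carrier) :
    HasDerivAt (fun s => dvg Ω (w s) x) (dvg Ω (dt w t) x) t :=
  HasDerivAt.fun_sum fun i _ => (EuclideanSpace.proj (𝕜 := ℝ) i).hasFDerivAt.comp_hasDerivAt t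
    (hw.hasDerivAt_pd i ht hx)

theorem continuousOn_dvg (hw : VelocityRegular Ω t₀ T w) :
    ContinuousOn (fun z : ℝ × Euc D => dvg Ω (w z.1) z.2) (timeCO t₀ T ×ˢ Ω.cl) :=
  continuousOn_finsetSum _ fun i _ => (EuclideanSpace.proj (𝕜 := ℝ) i).continuous.comp_continuousOn
    (hw.cont_pd i)

theorem continuousOn_dt (hw : VelocityRegular Ω t₀ T w) {t : ℝ} (ht : t ∈ timeOO t₀ T) :
    ContinuousOn (dt w t) Ω.cl :=
  hw.cont_dt.comp (f := fun y : Euc D => (t, y)) (by fun_prop) fun _ hy => ⟨ht, hy⟩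

theorem continuousOn_time (hw : VelocityRegular Ω t₀ T w) {x : Euc D} (hx : x ∈ Ω.cl) :
    ContinuousOn (fun s => w s x) (timeCO t₀ T) :=
  hw.cont.comp (f := fun s : ℝ => (s, x)) (by fun_prop) fun _ hs => ⟨hs, hx⟩

end VelocityRegular

end Time

/-! ### The weak maximum principle for the heat equation. -/

section MaxPrinciple

/-- The second derivative is nonpositive at a local maximum. -/
theorem deriv_deriv_nonpos_of_isLocalMax {g : ℝ → ℝ} {a : ℝ} (h : IsLocalMax g a)
    (hc : ContinuousAt g a) : deriv (deriv g) a ≤ 0 := by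
  by_contra! hpos
  -- A positive second derivative would make `a` a local minimum too, so `g` would be locally
  -- constant.
  have hmin := isLocalMin_of_deriv_deriv_pos hpos h.deriv_eq_zero hc
  have hconst : g =ᶠ[𝓝 a] fun _ => g a := by
    filter_upwards [h, hmin] with y h1 h2 using le_antisymm h1 h2
  rw [hconst.deriv.deriv_eq] at hpos
  simp at hpos

/-- Each pure second derivative is that of a restriction to a coordinate line, which also has a
local maximum. -/
theorem lap_nonpos_of_isLocalMax {Ω : C2Domain D} {f : Euc D → ℝ} {x : Euc D}
    (hf : ContDiffOn ℝ 2 f Ω.carrier) (hx : x ∈ Ω.carrier) (h : IsLocalMax f x) :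
    lap Ω f x ≤ 0 := by
  refine Finset.sum_nonpos fun i _ => ?_
  set e : Euc D := EuclideanSpace.single i 1 with he
  have hline : ∀ h : ℝ, HasDerivAt (fun h : ℝ => x + h • e) e h := fun h => by
    simpa using ((hasDerivAt_id h).smul_const e).const_add x
  have hcont : Continuous fun h : ℝ => x + h • e := by fun_prop
  have hx0 : x + (0 : ℝ) • e ∈ Ω.carrier := by simpa using hx
  have hev : ∀ᶠ h : ℝ in 𝓝 0, x + h • e ∈ Ω.carrier :=
    hcont.continuousAt.preimage_mem_nhds (Ω.isOpen.mem_nhds hx0)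
  have hpd : ∀ (g : Euc D → ℝ), ContDiffOn ℝ 1 g Ω.carrier → ∀ h : ℝ, x + h • e ∈ Ω.carrier →
      HasDerivAt (fun h : ℝ => g (x + h • e)) (pd Ω i g (x + h • e)) h := fun g hg h hh => by
    rw [pd_of_mem hh]
    exact (differentiableAt_of_contDiffOn one_ne_zero hg hh).hasFDerivAt.comp_hasDerivAt h
      (hline h)
  have hf1 : ContDiffOn ℝ 1 f Ω.carrier := hf.of_le (by norm_num)
  have e1 : deriv (fun h : ℝ => f (x + h • e)) =ᶠ[𝓝 0] fun h => pd Ω i f (x + h • e) :=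
    hev.mono fun h hh => (hpd f hf1 h hh).deriv
  have e2 := (hpd (pd Ω i f) (contDiffOn_pd_carrier hf (m := 1) le_rfl) 0 hx0).deriv
  rw [← e1.deriv_eq] at e2
  simp only [zero_smul, add_zero] at e2
  rw [← e2]
  refine deriv_deriv_nonpos_of_isLocalMax ?_ (hpd f hf1 0 hx0).continuousAt
  have h' : IsLocalMax f (x + (0 : ℝ) • e) := by simpa using h
  exact h'.comp_continuous (g := fun h : ℝ => x + h • e) hcont.continuousAt

/-- The weak maximum principle for the heat equation. -/
theorem heat_nonpos {Ω : C2Domain D} {ν t₀ : ℝ} {T : EReal} (hν : 0 < ν) {d : ℝ → Euc D → ℝ}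
    (hc : ContinuousOn (fun z : ℝ × Euc D => d z.1 z.2) (timeCO t₀ T ×ˢ Ω.cl))
    (hd : ∀ t ∈ timeOO t₀ T, ContDiffOn ℝ 2 (d t) Ω.carrier)
    (heat : ∀ t ∈ timeOO t₀ T, ∀ x ∈ Ω.carrier,
      HasDerivAt (fun s => d s x) (ν * lap Ω (d t) x) t)
    (hinit : ∀ x ∈ Ω.cl, d t₀ x ≤ 0) (hbd : ∀ t ∈ timeCO t₀ T, ∀ x ∈ Ω.bd, d t x ≤ 0)
    {t : ℝ} (ht : t ∈ timeCO t₀ T) {x : Euc D} (hx : x ∈ Ω.cl) : d t x ≤ 0 := by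
  -- The term `ε (t - t₀)` makes the inequality strict: at an interior maximum after `t₀`, `Δd ≤ 0`
  -- forces a strictly negative time derivative, which earlier times contradict.
  have main : ∀ ε > 0, d t x - ε * (t - t₀) ≤ 0 := by
    intro ε hε
    have hcK : ContinuousOn (fun z : ℝ × Euc D => d z.1 z.2 - ε * (z.1 - t₀))
        (Icc t₀ t ×ˢ Ω.cl) :=
      (hc.mono (prod_mono (Icc_subset_timeCO ht) subset_rfl)).sub (by fun_prop)
    obtain ⟨⟨t₁, x₁⟩, ⟨ht₁, hx₁⟩, hmax⟩ :=
      (isCompact_Icc.prod Ω.isCompact_cl).exists_isMaxOn ⟨(t, x), ⟨ht.1, le_rfl⟩, hx⟩ hcK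
    have ht₁' := Icc_subset_timeCO ht ht₁
    have hle : d t x - ε * (t - t₀) ≤ d t₁ x₁ - ε * (t₁ - t₀) :=
      hmax (a := (t, x)) ⟨⟨ht.1, le_rfl⟩, hx⟩
    have hnn : 0 ≤ ε * (t₁ - t₀) := mul_nonneg hε.le (sub_nonneg.2 ht₁.1)
    refine hle.trans ?_
    rcases Ω.mem_or_mem_of_mem_cl hx₁ with hin | hb
    swap
    · linarith [hbd t₁ ht₁' x₁ hb]
    by_cases h0 : t₁ = t₀
    · subst h0; linarith [hinit x₁ hx₁]
    exfalso
    have hOO := mem_timeOO_of_ne ht₁' h0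
    have hlap : lap Ω (d t₁) x₁ ≤ 0 := by
      refine lap_nonpos_of_isLocalMax (hd t₁ hOO) hin ?_
      filter_upwards [Ω.cl_mem_nhds hin] with y hy
      have : d t₁ y - ε * (t₁ - t₀) ≤ d t₁ x₁ - ε * (t₁ - t₀) := hmax (a := (t₁, y)) ⟨ht₁, hy⟩
      linarith
    have hder : HasDerivAt (fun s => d s x₁ - ε * (s - t₀)) (ν * lap Ω (d t₁) x₁ - ε) t₁ := by
      simpa using (heat t₁ hOO x₁ hin).fun_sub (((hasDerivAt_id t₁).sub_const t₀).const_mul ε)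
    have hneg : ν * lap Ω (d t₁) x₁ - ε < 0 := by
      nlinarith [mul_nonneg hν.le (neg_nonneg.2 hlap)]
    -- Only left slopes are usable, since `t₁` may be the final time `t`.
    have hslope := (hasDerivAt_iff_tendsto_slope_left_right.1 hder).1
    have hev := (hslope.eventually (gt_mem_nhds hneg)).and
      (Ioo_mem_nhdsLT (lt_of_le_of_ne ht₁.1 (Ne.symm h0)))
    obtain ⟨s, hs, hs1, hs2⟩ := hev.exists
    have h2 : d s x₁ - ε * (s - t₀) ≤ d t₁ x₁ - ε * (t₁ - t₀) :=
      hmax (a := (s, x₁)) ⟨⟨hs1.le, hs2.le.trans ht₁.2⟩, hx₁⟩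
    rw [slope_def_field, div_lt_iff_of_neg (by linarith)] at hs
    linarith
  by_contra! hpos
  have h1 : 0 ≤ t - t₀ := sub_nonneg.2 ht.1
  -- With this `ε` the correction is at most `d t x / 2`; the `+ 1` covers `t = t₀`.
  have := main (d t x / (2 * (t - t₀ + 1))) (by positivity)
  rw [sub_nonpos, div_mul_eq_mul_div, le_div_iff₀ (by positivity)] at this
  nlinarith

theorem heat_eq_zero {Ω : C2Domain D} {ν t₀ : ℝ} {T : EReal} (hν : 0 < ν) {d : ℝ → Euc D → ℝ}
    (hc : ContinuousOn (fun z : ℝ × Euc D => d z.1 z.2) (timeCO t₀ T ×ˢ Ω.cl))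
    (hd : ∀ t ∈ timeOO t₀ T, ContDiffOn ℝ 2 (d t) Ω.carrier)
    (heat : ∀ t ∈ timeOO t₀ T, ∀ x ∈ Ω.carrier,
      HasDerivAt (fun s => d s x) (ν * lap Ω (d t) x) t)
    (hinit : ∀ x ∈ Ω.cl, d t₀ x = 0) (hbd : ∀ t ∈ timeCO t₀ T, ∀ x ∈ Ω.bd, d t x = 0)
    {t : ℝ} (ht : t ∈ timeCO t₀ T) {x : Euc D} (hx : x ∈ Ω.cl) : d t x = 0 := by
  refine le_antisymm (heat_nonpos hν hc hd heat (fun y hy => (hinit y hy).le)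
    (fun s hs y hy => (hbd s hs y hy).le) ht hx) (neg_nonpos.1 ?_)
  refine heat_nonpos hν (d := fun s y => -d s y) hc.neg (fun s hs => (hd s hs).neg)
    (fun s hs y hy => ?_) (fun y hy => by simp [hinit y hy])
    (fun s hs y hy => by simp [hbd s hs y hy]) ht hx
  have e : lap Ω (fun y => -d s y) y = -lap Ω (d s) y := by
    simp only [lap, ← Finset.sum_neg_distrib]
    refine Finset.sum_congr rfl fun i _ => ?_
    rw [pd_congr_carrier (fun z hz => pd_neg (Ω.carrier_subset_cl hz)) hy,
      pd_neg (Ω.carrier_subset_cl hy)]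
  rw [e, mul_neg]
  exact (heat s hs y hy).neg

end MaxPrinciple

/-! ### The Hopf lemma, the strong maximum principle and the Neumann problem. -/

section Hopf

variable {Ω : C2Domain D}

theorem hasFDerivAt_sq_sub_norm_sq (c : Euc D) (r : ℝ) (y : Euc D) :
    HasFDerivAt (fun y => r ^ 2 - ‖y - c‖ ^ 2) (-(2 • innerSL ℝ (y - c))) y := by
  simpa using ((hasFDerivAt_id y).sub_const c).norm_sq.const_sub (r ^ 2)

theorem pd_quadratic_barrier (a r : ℝ) (c : Euc D) (i : Fin D) {y : Euc D} (hy : y ∈ Ω.carrier) :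
    pd Ω i (fun y => (r ^ 2 - ‖y - c‖ ^ 2) + a * (r ^ 2 - ‖y - c‖ ^ 2) ^ 2) y
      = (1 + 2 * a * (r ^ 2 - ‖y - c‖ ^ 2)) * (-2 * (y i - c i)) := by
  have h := hasFDerivAt_sq_sub_norm_sq c r y
  have h2 : HasFDerivAt
      (fun y => (r ^ 2 - ‖y - c‖ ^ 2) + a * (r ^ 2 - ‖y - c‖ ^ 2) ^ 2) _ y :=
    h.fun_add ((h.pow 2).const_mul a)
  rw [pd_of_mem hy, h2.fderiv]
  simp [EuclideanSpace.inner_single_right]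
  ring

theorem pd_pd_quadratic_barrier (a r : ℝ) (c : Euc D) (i : Fin D) {y : Euc D}
    (hy : y ∈ Ω.carrier) :
    pd Ω i (pd Ω i (fun y => (r ^ 2 - ‖y - c‖ ^ 2) + a * (r ^ 2 - ‖y - c‖ ^ 2) ^ 2)) y
      = 8 * a * (y i - c i) ^ 2 - 2 * (1 + 2 * a * (r ^ 2 - ‖y - c‖ ^ 2)) := by
  have h := hasFDerivAt_sq_sub_norm_sq c r y
  have h2 : HasFDerivAt (fun y : Euc D => y i - c i) (EuclideanSpace.proj (𝕜 := ℝ) i) y :=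
    (EuclideanSpace.proj (𝕜 := ℝ) i).hasFDerivAt.sub_const _
  rw [pd_congr_carrier (fun z hz => pd_quadratic_barrier a r c i hz) hy, pd_of_mem hy,
    (((h.const_mul (2 * a)).const_add 1).fun_mul (h2.const_mul (-2))).fderiv]
  simp [EuclideanSpace.inner_single_right]
  ring

/-- A polynomial barrier in place of the usual exponential one: it vanishes on the sphere of radius
`r`, and for suitable `a > 0` the quadratic term makes it strictly subharmonic near that sphere. -/
theorem lap_quadratic_barrier (a r : ℝ) (c : Euc D) {y : Euc D} (hy : y ∈ Ω.carrier) :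
    lap Ω (fun y => (r ^ 2 - ‖y - c‖ ^ 2) + a * (r ^ 2 - ‖y - c‖ ^ 2) ^ 2) y
      = 8 * a * ‖y - c‖ ^ 2 - 2 * D * (1 + 2 * a * (r ^ 2 - ‖y - c‖ ^ 2)) := by
  simp only [lap, pd_pd_quadratic_barrier a r c _ hy, Finset.sum_sub_distrib, ← Finset.mul_sum]
  rw [EuclideanSpace.real_norm_sq_eq (y - c)]
  simp
  ring

/-- The Hopf boundary point lemma on an interior ball. -/
theorem hopf {ψ : Euc D → ℝ} {M r : ℝ} {c x : Euc D} (hr : 0 < r)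
    (hψ1 : ContDiffOn ℝ 1 ψ Ω.cl) (hψ2 : ContDiffOn ℝ 2 ψ Ω.carrier)
    (hlap : ∀ y ∈ Ω.carrier, lap Ω ψ y = 0)
    (hball : Metric.ball c r ⊆ Ω.carrier) (hlt : ∀ y ∈ Metric.ball c r, ψ y < M)
    (hle : ∀ y ∈ Metric.closedBall c r, ψ y ≤ M) (hx : dist x c = r) (hxM : ψ x = M) :
    fderivWithin ℝ ψ Ω.cl x (c - x) < 0 := by
  have hcl : Metric.closedBall c r ⊆ Ω.cl := by
    rw [← closure_ball c hr.ne']; exact closure_mono hball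
  set s : Euc D → ℝ := fun y => r ^ 2 - ‖y - c‖ ^ 2 with hs
  have hsc : Continuous s := by fun_prop
  -- `s0` and `a` are chosen so that `a r² = D + 1` and `a s (D + 2) ≤ D + 1` whenever `s ≤ s0`; the
  -- Laplacian of the barrier is then at least `2 D + 4`.
  set s0 : ℝ := r ^ 2 / (D + 2) with hs0
  have hs0p : 0 < s0 := by positivity
  set a : ℝ := (D + 1) / r ^ 2 with ha
  have hap : 0 < a := by positivity
  set h : Euc D → ℝ := fun y => s y + a * s y ^ 2 with hh
  have hhc : ContDiff ℝ 2 h := by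
    have : ContDiff ℝ 2 s := contDiff_const.sub ((contDiff_id.sub contDiff_const).norm_sq ℝ)
    exact this.add (contDiff_const.mul (this.pow 2))
  have hmem : ∀ y, 0 ≤ s y ↔ y ∈ Metric.closedBall c r := fun y => by
    rw [mem_closedBall_iff_norm, hs, sub_nonneg]; exact sq_le_sq₀ (norm_nonneg _) hr.le
  have hmem' : ∀ y, 0 < s y ↔ y ∈ Metric.ball c r := fun y => by
    rw [mem_ball_iff_norm, hs, sub_pos]; exact sq_lt_sq₀ (norm_nonneg _) hr.le
  have hlaph : ∀ y ∈ Ω.carrier, s y ≤ s0 → 0 < lap Ω h y := by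
    intro y hy hys
    rw [lap_quadratic_barrier a r c hy]
    have e1 : ‖y - c‖ ^ 2 = r ^ 2 - s y := by simp [hs]
    have e2 : r ^ 2 - ‖y - c‖ ^ 2 = s y := rfl
    have e3 : a * r ^ 2 = D + 1 := by rw [ha]; field_simp
    have e4 : s y * (D + 2) ≤ r ^ 2 := by rwa [hs0, le_div_iff₀ (by positivity)] at hys
    rw [e2, e1]
    have : a * (s y * (D + 2)) ≤ D + 1 := by
      rw [← e3]; exact mul_le_mul_of_nonneg_left e4 hap.le
    have hD : (0 : ℝ) ≤ D := Nat.cast_nonneg D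
    nlinarith
  -- On the compact inner sphere `s = s0`, `ψ` stays below `M` by a positive gap; `k` scales the
  -- barrier to fit into it.
  obtain ⟨k, hk, hkin⟩ : ∃ k > 0, ∀ y, s y = s0 → ψ y + k * h y ≤ M := by
    have hcomp : IsCompact {y | s y = s0} := by
      refine (isCompact_closedBall c r).of_isClosed_subset (isClosed_eq hsc continuous_const) ?_
      intro y hy
      exact (hmem y).1 (by rw [show s y = s0 from hy]; exact hs0p.le)
    have hsub : {y | s y = s0} ⊆ Metric.ball c r := fun y hy =>
      (hmem' y).1 (by rw [show s y = s0 from hy]; exact hs0p)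
    have hψc : ContinuousOn ψ {y | s y = s0} :=
      hψ1.continuousOn.mono (hsub.trans (hball.trans Ω.carrier_subset_cl))
    rcases ({y | s y = s0}).eq_empty_or_nonempty with he | hne
    -- The level set is empty only for `D = 0`; then any `k` works.
    · refine ⟨1, one_pos, fun y hy => ?_⟩
      have : y ∈ ({y | s y = s0} : Set (Euc D)) := hy
      rw [he] at this; exact this.elim
    obtain ⟨z, hz, hmax⟩ := hcomp.exists_isMaxOn hne hψc
    have hzM : 0 < M - ψ z := sub_pos.2 (hlt z (hsub hz))
    have hb : 0 < s0 + a * s0 ^ 2 := by positivity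
    refine ⟨(M - ψ z) / (s0 + a * s0 ^ 2), by positivity, fun y hy => ?_⟩
    have h1 : ψ y ≤ ψ z := hmax (show y ∈ {y | s y = s0} from hy)
    have h2 : h y = s0 + a * s0 ^ 2 := by simp only [hh, hy]
    rw [h2, div_mul_cancel₀ _ hb.ne']
    linarith
  -- comparison on the annulus
  have hA : ∀ y, 0 ≤ s y → s y ≤ s0 → ψ y + k * h y ≤ M := by
    have hcomp : IsCompact {y | 0 ≤ s y ∧ s y ≤ s0} := by
      refine (isCompact_closedBall c r).of_isClosed_subset ?_ fun y hy => (hmem y).1 hy.1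
      exact (isClosed_le continuous_const hsc).inter (isClosed_le hsc continuous_const)
    have hvc : ContinuousOn (fun y => ψ y + k * h y) {y | 0 ≤ s y ∧ s y ≤ s0} :=
      (hψ1.continuousOn.mono fun y hy => hcl ((hmem y).1 hy.1)).add
        (continuous_const.mul hhc.continuous).continuousOn
    intro y hy1 hy2
    obtain ⟨z, ⟨hz1, hz2⟩, hmax⟩ := hcomp.exists_isMaxOn ⟨y, hy1, hy2⟩ hvc
    have hyz : ψ y + k * h y ≤ ψ z + k * h z :=
      hmax (show y ∈ {y | 0 ≤ s y ∧ s y ≤ s0} from ⟨hy1, hy2⟩)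
    refine hyz.trans ?_
    rcases hz1.eq_or_lt with hz0 | hz0
    · have : h z = 0 := by simp [hh, ← hz0]
      rw [this, mul_zero, add_zero]
      exact hle z ((hmem z).1 hz1)
    rcases hz2.eq_or_lt with hz3 | hz3
    · exact hkin z hz3
    exfalso
    have hzU : z ∈ Ω.carrier := hball ((hmem' z).1 hz0)
    have hkh : ContDiffOn ℝ 2 (fun y => k • h y) Ω.carrier :=
      (contDiff_const.mul hhc).contDiffOn
    -- A maximum inside the annulus is impossible, because there `Δ(ψ + k h) = k Δh > 0`.
    have hloc : IsLocalMax (fun y => ψ y + k • h y) z := by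
      filter_upwards [hsc.continuousAt.eventually (lt_mem_nhds hz0),
        hsc.continuousAt.eventually (gt_mem_nhds hz3)] with y h1 h2
      exact hmax (show y ∈ {y | 0 ≤ s y ∧ s y ≤ s0} from ⟨h1.le, h2.le⟩)
    have h1 := lap_nonpos_of_isLocalMax (hψ2.add hkh) hzU hloc
    rw [lap_add hψ2 hkh hzU, hlap z hzU, zero_add] at h1
    have h2 : lap Ω (fun y => k • h y) z = k * lap Ω h z := by
      simp only [lap, Finset.mul_sum]
      refine Finset.sum_congr rfl fun i _ => ?_
      rw [pd_congr_carrier (fun w hw => pd_const_smul k (Ω.carrier_subset_cl hw)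
        (hhc.differentiable two_ne_zero w).differentiableWithinAt) hzU,
        pd_const_smul k (Ω.carrier_subset_cl hzU) (differentiableWithinAt_of_contDiffOn one_ne_zero
          (contDiffOn_pd_carrier hhc.contDiffOn (m := 1) (n := 2) le_rfl) hzU), smul_eq_mul]
    rw [h2] at h1
    exact absurd h1 (not_le.2 (mul_pos hk (hlaph z hzU hz3.le)))
  -- derivative along the inner radius
  have hxcl : x ∈ Ω.cl := hcl (by simp [hx])
  set γ : ℝ → Euc D := fun τ => x + τ • (c - x) with hγ
  have hγd : HasDerivAt γ (c - x) 0 := by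
    rw [hγ]
    simpa using ((hasDerivAt_id (0 : ℝ)).smul_const (c - x)).const_add x
  have hsγ : ∀ τ, s (γ τ) = r ^ 2 * (2 * τ - τ ^ 2) := fun τ => by
    have e : γ τ - c = (1 - τ) • (x - c) := by simp only [hγ]; module
    simp only [hs, e, norm_smul, mul_pow, ← dist_eq_norm x c, hx, Real.norm_eq_abs, sq_abs]
    ring
  have hmaps : MapsTo γ (Icc 0 1) Ω.cl := fun τ hτ => hcl ((hmem _).1 (by
    rw [hsγ]; have := hτ.1; have := hτ.2; have : 0 ≤ 2 * τ - τ ^ 2 := by nlinarith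
    positivity))
  have hder : HasDerivWithinAt (fun τ => ψ (γ τ)) (fderivWithin ℝ ψ Ω.cl x (c - x)) (Icc 0 1) 0 := by
    have hd : HasFDerivWithinAt ψ (fderivWithin ℝ ψ Ω.cl x) Ω.cl (γ 0) := by
      simpa [hγ] using (hψ1.differentiableOn one_ne_zero x hxcl).hasFDerivWithinAt
    exact hd.comp_hasDerivWithinAt 0 hγd.hasDerivWithinAt hmaps
  -- Along the radius `s = r² (2τ - τ²) ≥ r² τ` on `[0, 1]`, so for small `τ` the function `ψ` lies
  -- below the line `M - k r² τ`, with equality at `τ = 0`; comparing right derivatives gives the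
  -- sign.
  have hder2 : HasDerivAt (fun τ : ℝ => M - k * (r ^ 2 * τ)) (-(k * r ^ 2)) 0 := by
    simpa using (((hasDerivAt_id (0 : ℝ)).const_mul (r ^ 2)).const_mul k).const_sub M
  have hder3 := hder2.hasDerivWithinAt (s := Icc 0 1) |>.fun_sub hder
  have hfin : 0 ≤ -(k * r ^ 2) - fderivWithin ℝ ψ Ω.cl x (c - x) := by
    have hw : HasDerivWithinAt _ _ (Ioi (0 : ℝ)) 0 :=
      (hder3.mono Ioc_subset_Icc_self).mono_of_mem_nhdsWithin (Ioc_mem_nhdsGT one_pos)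
    have hsl := (hasDerivWithinAt_iff_tendsto_slope' (by simp)).1 hw
    refine ge_of_tendsto hsl ?_
    have hsmall : ∀ᶠ τ in 𝓝[>] (0 : ℝ), s (γ τ) < s0 := by
      have hc0 : Continuous fun τ => s (γ τ) := by fun_prop
      refine nhdsWithin_le_nhds (hc0.continuousAt.eventually (gt_mem_nhds ?_))
      simpa [hsγ] using hs0p
    filter_upwards [hsmall, Ioc_mem_nhdsGT (zero_lt_one' ℝ)] with τ h1 h2
    have h3 := h2.1
    have h4 := h2.2
    have h6 : τ ≤ 2 * τ - τ ^ 2 := by nlinarith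
    have h5 : r ^ 2 * τ ≤ s (γ τ) := by
      rw [hsγ]; exact mul_le_mul_of_nonneg_left h6 (by positivity)
    have h8 : 0 ≤ s (γ τ) := le_trans (by positivity) h5
    have h7 := hA (γ τ) h8 h1.le
    have h9 : k * (r ^ 2 * τ) ≤ k * h (γ τ) := by
      apply mul_le_mul_of_nonneg_left _ hk.le
      have : 0 ≤ a * s (γ τ) ^ 2 := by positivity
      simp only [hh]; linarith
    rw [slope_def_field]
    have hγ0 : ψ (γ 0) = M := by simp [hγ, hxM]
    apply div_nonneg _ (by linarith)
    simp only [hγ0]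
    linarith
  have : 0 < k * r ^ 2 := by positivity
  linarith

/-- The strong maximum principle: a harmonic function with an interior maximum is constant. -/
theorem eqOn_of_isMaxOn {ψ : Euc D → ℝ} {M : ℝ}
    (hψ1 : ContDiffOn ℝ 1 ψ Ω.cl) (hψ2 : ContDiffOn ℝ 2 ψ Ω.carrier)
    (hlap : ∀ y ∈ Ω.carrier, lap Ω ψ y = 0) (hle : ∀ y ∈ Ω.cl, ψ y ≤ M)
    {x : Euc D} (hx : x ∈ Ω.carrier) (hxM : ψ x = M) : ∀ y ∈ Ω.carrier, ψ y = M := by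
  have hcont : ContinuousOn ψ Ω.carrier := hψ2.continuousOn
  have hopen1 : IsOpen {y | y ∈ Ω.carrier ∧ ψ y < M} :=
    hcont.isOpen_inter_preimage Ω.isOpen isOpen_Iio
  have hopen2 : IsOpen {y | y ∈ Ω.carrier ∧ ψ y = M} := by
    rw [Metric.isOpen_iff]
    rintro z ⟨hz, hzM⟩
    obtain ⟨R, hR, hRU⟩ := Metric.isOpen_iff.1 Ω.isOpen z hz
    -- With radius `R / 2`, the closed ball about `c` contains `z` and still lies in the domain.
    refine ⟨R / 2, by positivity, fun c hc => ?_⟩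
    rw [Metric.mem_ball] at hc
    refine ⟨hRU (Metric.mem_ball.2 (by linarith)), ?_⟩
    by_contra hcM
    have hsub : Metric.closedBall c (R / 2) ⊆ Ω.carrier := fun y hy => hRU (by
      rw [Metric.mem_closedBall] at hy
      rw [Metric.mem_ball]
      linarith [dist_triangle y c z])
    have hK : IsCompact (Metric.closedBall c (R / 2) ∩ ψ ⁻¹' {M}) :=
      (isCompact_closedBall c _).of_isClosed_subset
        ((hcont.mono hsub).preimage_isClosed_of_isClosed Metric.isClosed_closedBall
          isClosed_singleton) inter_subset_left
    -- For `y` a point of `{ψ = M}` nearest to `c`, the open ball about `c` through `y` has `ψ < M`.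
    -- Hopf gives a nonzero derivative at `y`, yet `y` is an interior maximum.
    obtain ⟨y, ⟨hy1, hy2⟩, hmin⟩ := hK.exists_isMinOn
      ⟨z, Metric.mem_closedBall.2 (by rw [dist_comm]; exact hc.le), hzM⟩
      (f := fun y => dist y c) (by fun_prop)
    have hy2 : ψ y = M := hy2
    have hyU := hsub hy1
    rw [Metric.mem_closedBall] at hy1
    have hr : 0 < dist y c := dist_pos.2 fun e => hcM (e ▸ hy2)
    have hsub2 : Metric.closedBall c (dist y c) ⊆ Metric.closedBall c (R / 2) :=
      Metric.closedBall_subset_closedBall hy1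
    have hcb : ∀ w ∈ Metric.closedBall c (dist y c), ψ w ≤ M := fun w hw =>
      hle w (Ω.carrier_subset_cl (hsub (hsub2 hw)))
    have hH := hopf hr hψ1 hψ2 hlap
      (Metric.ball_subset_closedBall.trans (hsub2.trans hsub))
      (fun w hw => lt_of_le_of_ne (hcb w (Metric.ball_subset_closedBall hw)) fun e => by
        have h1 : dist y c ≤ dist w c :=
          hmin (show w ∈ Metric.closedBall c (R / 2) ∩ ψ ⁻¹' {M} from
            ⟨hsub2 (Metric.ball_subset_closedBall hw), e⟩)
        exact absurd (Metric.mem_ball.1 hw) (not_lt.2 h1))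
      hcb rfl hy2
    have hloc : IsLocalMax ψ y := by
      filter_upwards [Ω.cl_mem_nhds hyU] with w hw
      rw [hy2]; exact hle w hw
    rw [fderivWithin_of_mem_nhds (Ω.cl_mem_nhds hyU), hloc.fderiv_eq_zero] at hH
    simp at hH
  have := Ω.isConnected.isPreconnected.subset_left_of_subset_union hopen2 hopen1
    (by rw [Set.disjoint_left]; rintro y ⟨_, h1⟩ ⟨_, h2⟩; exact h2.ne h1)
    (fun y hy => (hle y (Ω.carrier_subset_cl hy)).eq_or_lt.imp (fun h => ⟨hy, h⟩) fun h => ⟨hy, h⟩)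
    ⟨x, hx, hx, hxM⟩
  exact fun y hy => (this hy).2

/-- A harmonic function with vanishing normal derivative has vanishing gradient. -/
theorem grad_eq_zero_of_neumann {ψ : Euc D → ℝ}
    (hψ1 : ContDiffOn ℝ 1 ψ Ω.cl) (hψ2 : ContDiffOn ℝ 2 ψ Ω.carrier)
    (hlap : ∀ y ∈ Ω.carrier, lap Ω ψ y = 0)
    (hn : ∀ y ∈ Ω.bd, inner ℝ (Ω.normal y) (grad Ω ψ y) = 0) : ∀ y ∈ Ω.cl, grad Ω ψ y = 0 := by
  obtain ⟨x, hx, hmax⟩ := Ω.isCompact_cl.exists_isMaxOn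
    (Ω.isConnected.nonempty.mono Ω.carrier_subset_cl) hψ1.continuousOn
  have hle : ∀ y ∈ Ω.cl, ψ y ≤ ψ x := fun y hy => hmax hy
  -- Were the maximum attained on the boundary only, Hopf on an interior ball would contradict the
  -- zero normal derivative.
  have hin : ∃ z ∈ Ω.carrier, ψ z = ψ x := by
    by_contra! hne
    rcases Ω.mem_or_mem_of_mem_cl hx with h | h
    · exact hne x h rfl
    obtain ⟨r, hr, hb⟩ := Ω.exists_ball_subset h
    have hcl : Metric.closedBall (x - r • Ω.normal x) r ⊆ Ω.cl := by
      rw [← closure_ball _ hr.ne']; exact closure_mono hb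
    have hH := hopf hr hψ1 hψ2 hlap hb
      (fun y hy => lt_of_le_of_ne (hle y (Ω.carrier_subset_cl (hb hy))) (hne y (hb hy)))
      (fun y hy => hle y (hcl hy))
      (by simp [norm_smul, Ω.norm_normal h, abs_of_pos hr]) rfl
    rw [show x - r • Ω.normal x - x = (-r) • Ω.normal x by module, map_smul,
      fderivWithin_eq_inner_grad, hn x h, smul_zero] at hH
    exact lt_irrefl _ hH
  obtain ⟨z, hz, hzM⟩ := hin
  have hconst : EqOn ψ (fun _ => ψ x) Ω.cl := Ω.eqOn_cl hψ1.continuousOn continuousOn_const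
    fun y hy => eqOn_of_isMaxOn hψ1 hψ2 hlap hle hz hzM y hy
  intro y hy
  ext i
  have := pd_congr_cl (i := i) hconst hy
  simpa [grad, pd] using this

end Hopf

/-! ### Evolution laws of `∇ · w` and `n · w`, and the equivalence with the INSE. -/

section Momentum

variable {Ω : C2Domain D} {ν lam t₀ : ℝ} {T : EReal} {g w u : ℝ → Euc D → Euc D}
  {p q φ : ℝ → Euc D → ℝ} {t : ℝ} {x : Euc D}

theorem VelocityRegular.dvg_eq_zero_on_cl (hu : VelocityRegular Ω t₀ T u) (ht : t ∈ timeCO t₀ T)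
    (h : ∀ x ∈ Ω.carrier, dvg Ω (u t) x = 0) : ∀ x ∈ Ω.cl, dvg Ω (u t) x = 0 :=
  Ω.eqOn_cl (contDiffOn_dvg_cl (m := 0) (n := 1) (hu.contDiffOn_one t ht) le_rfl).continuousOn
    continuousOn_const h

/-- The divergence of the momentum equation. -/
theorem dvg_dt_of_momentum (hg : ForceRegular Ω t₀ T g) (hw : VelocityRegular Ω t₀ T w)
    (hu : VelocityRegular Ω t₀ T u) (hq : PressureRegular Ω t₀ T q) (ht : t ∈ timeOO t₀ T)
    (hmom : ∀ x ∈ Ω.carrier,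
      dt w t x = g t x - convect Ω (u t) x - grad Ω (q t) x + ν • lap Ω (w t) x)
    (hx : x ∈ Ω.carrier) :
    dvg Ω (dt w t) x = dvg Ω (fun y => g t y - convect Ω (u t) y) x - lap Ω (q t) x
      + ν * lap Ω (dvg Ω (w t)) x := by
  have hxc := Ω.carrier_subset_cl hx
  have hc : ContDiffOn ℝ 1 (convect Ω (u t)) Ω.carrier :=
    (contDiffOn_convect (m := 1) (n := 2) (hu.contDiffOn_two t ht) le_rfl).mono
      Ω.carrier_subset_cl
  have h1 : ContDiffOn ℝ 1 (fun y => g t y - convect Ω (u t) y) Ω.carrier :=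
    (hg.contDiffOn_one t ht).sub hc
  have h2 : ContDiffOn ℝ 1 (grad Ω (q t)) Ω.carrier :=
    contDiffOn_grad_carrier (m := 1) (n := 2) (hq.contDiffOn_two t ht) le_rfl
  have h3 : ContDiffOn ℝ 1 (lap Ω (w t)) Ω.carrier :=
    contDiffOn_lap_carrier (m := 1) (n := 3) (hw.contDiffOn_three t ht) le_rfl
  have d1 := differentiableWithinAt_of_contDiffOn one_ne_zero h1 hx
  have d2 := differentiableWithinAt_of_contDiffOn one_ne_zero h2 hx
  have d3 := differentiableWithinAt_of_contDiffOn one_ne_zero h3 hx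
  rw [dvg_congr_carrier hmom hx, dvg_add hxc (d1.fun_sub d2) (d3.fun_const_smul ν),
    dvg_sub hxc d1 d2, dvg_const_smul ν hxc d3, dvg_grad (hq.contDiffOn_two t ht) hx,
    dvg_lap (hw.contDiffOn_three t ht) hx]

/-- The momentum equation holds up to the boundary. -/
theorem momentum_on_cl (hg : ForceRegular Ω t₀ T g) (hw : VelocityRegular Ω t₀ T w)
    (hu : VelocityRegular Ω t₀ T u) (hq : PressureRegular Ω t₀ T q) (ht : t ∈ timeOO t₀ T)
    (hmom : ∀ x ∈ Ω.carrier,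
      dt w t x = g t x - convect Ω (u t) x - grad Ω (q t) x + ν • lap Ω (w t) x) :
    ∀ x ∈ Ω.cl, dt w t x = g t x - convect Ω (u t) x - grad Ω (q t) x + ν • lap Ω (w t) x := by
  refine Ω.eqOn_cl (hw.continuousOn_dt ht) ?_ hmom
  have h1 := contDiffOn_convect (m := 1) (n := 2) (hu.contDiffOn_two t ht) le_rfl
  have h2 := contDiffOn_grad_cl (m := 0) (n := 1) (hq.contDiffOn_one t ht) le_rfl
  have h3 := contDiffOn_lap_cl (m := 0) (n := 2) (hw.contDiffOn_two t ht) le_rfl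
  exact (((hg.cont t ht).sub h1.continuousOn).sub h2.continuousOn).add
    (h3.continuousOn.const_smul ν)

/-- The normal trace makes sense because every term of the momentum equation extends continuously to
the boundary. -/
theorem inner_normal_dt_of_momentum (hg : ForceRegular Ω t₀ T g) (hw : VelocityRegular Ω t₀ T w)
    (hu : VelocityRegular Ω t₀ T u) (hq : PressureRegular Ω t₀ T q) (ht : t ∈ timeOO t₀ T)
    (hmom : ∀ x ∈ Ω.carrier,
      dt w t x = g t x - convect Ω (u t) x - grad Ω (q t) x + ν • lap Ω (w t) x)
    (hx : x ∈ Ω.bd) :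
    (inner ℝ (Ω.normal x) (dt w t x) : ℝ)
      = inner ℝ (Ω.normal x) (g t x - convect Ω (u t) x + ν • lap Ω (w t) x)
        - inner ℝ (Ω.normal x) (grad Ω (q t) x) := by
  rw [momentum_on_cl hg hw hu hq ht hmom x (Ω.bd_subset_cl hx), ← inner_sub_right]
  congr 1
  abel

theorem VelocityRegular.hasDerivAt_inner_normal (hw : VelocityRegular Ω t₀ T w)
    (ht : t ∈ timeOO t₀ T) (hx : x ∈ Ω.bd) :
    HasDerivAt (fun s => (inner ℝ (Ω.normal x) (w s x) : ℝ)) (inner ℝ (Ω.normal x) (dt w t x)) t :=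
  (innerSL ℝ (Ω.normal x)).hasFDerivAt.comp_hasDerivAt t
    (hw.differentiableAt_time t ht x (Ω.bd_subset_cl hx)).hasDerivAt

/-- The Poisson equation cancels the forcing, convection and pressure terms in the divergence of the
momentum equation. -/
theorem IsGePUPE.divergenceHeat (hg : ForceRegular Ω t₀ T g)
    (h : IsGePUPE Ω ν lam t₀ T g w u q) : DivergenceHeat Ω ν t₀ T w := by
  intro t ht x hx
  have := dvg_dt_of_momentum hg h.regular_w h.regular_u h.regular_q ht (h.momentum t ht) hx
  rw [h.pressure_poisson t ht x hx, sub_self, zero_add] at this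
  exact this ▸ h.regular_w.hasDerivAt_dvg ht hx

/-- The Neumann condition cancels all of the normal momentum balance except the damping term. -/
theorem IsGePUPE.normalDecay (hg : ForceRegular Ω t₀ T g)
    (h : IsGePUPE Ω ν lam t₀ T g w u q) : NormalDecay Ω lam t₀ T w := by
  intro t ht x hx
  have := inner_normal_dt_of_momentum hg h.regular_w h.regular_u h.regular_q ht (h.momentum t ht) hx
  rw [h.pressure_neumann t ht x hx, sub_add_cancel_left, ← neg_mul] at this
  exact this ▸ h.regular_w.hasDerivAt_inner_normal ht hx

/-- The product `exp (lam s) * y s` has zero derivative, so the mean value theorem carries its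
initial value to time `t`; continuity at `t₀` suffices there. -/
theorem eq_zero_of_linear_decay {y : ℝ → ℝ} (hc : ContinuousOn y (timeCO t₀ T))
    (hd : ∀ t ∈ timeOO t₀ T, HasDerivAt y (-lam * y t) t) (h0 : y t₀ = 0) (ht : t ∈ timeCO t₀ T) :
    y t = 0 := by
  rcases ht.1.eq_or_lt with rfl | hlt
  · exact h0
  obtain ⟨s, -, hs⟩ := exists_hasDerivAt_eq_slope (fun s => Real.exp (lam * s) * y s) (fun _ => 0)
    hlt ((Continuous.continuousOn (by fun_prop)).mul (hc.mono (Icc_subset_timeCO ht)))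
    (fun s hs => by
      have hs' : s ∈ timeOO t₀ T := ⟨hs.1, (EReal.coe_lt_coe_iff.2 hs.2).trans ht.2⟩
      have h1 : HasDerivAt (fun s => Real.exp (lam * s)) (Real.exp (lam * s) * lam) s := by
        simpa using ((hasDerivAt_id s).const_mul lam).exp
      have h2 := h1.fun_mul (hd s hs')
      have e : Real.exp (lam * s) * lam * y s + Real.exp (lam * s) * (-lam * y s) = 0 := by ring
      exact e ▸ h2)
  rw [h0, mul_zero, sub_zero, eq_comm, div_eq_zero_iff] at hs
  rcases hs with hs | hs
  · exact (mul_eq_zero.1 hs).resolve_left (Real.exp_ne_zero _)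
  · linarith

/-- The Leray-Helmholtz projection leaves solenoidal tangential fields unchanged. -/
theorem eq_of_isLerayProjection {v w : Euc D → Euc D} (hv : ContDiffOn ℝ 1 v Ω.cl)
    (hw : ContDiffOn ℝ 1 w Ω.cl) (h : IsLerayProjection Ω w v)
    (hdw : ∀ x ∈ Ω.carrier, dvg Ω w x = 0)
    (hnw : ∀ x ∈ Ω.bd, inner ℝ (Ω.normal x) (w x) = 0) : ∀ x ∈ Ω.cl, w x = v x := by
  obtain ⟨⟨ψ, hψ1, hψ2, hψ⟩, hdv, hnv⟩ := h
  have hgr : EqOn (grad Ω ψ) (fun y => w y - v y) Ω.cl := fun y hy => by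
    simp [hψ y hy]
  -- Both fields are solenoidal and tangential, so the potential of their difference is harmonic
  -- with zero Neumann data.
  have hzero := grad_eq_zero_of_neumann hψ1 hψ2 (fun y hy => by
      have hyc := Ω.carrier_subset_cl hy
      rw [← dvg_grad hψ2 hy, dvg_congr_cl hgr hyc,
        dvg_sub hyc (hw.differentiableOn one_ne_zero y hyc)
          (hv.differentiableOn one_ne_zero y hyc), hdw y hy, hdv y hy, sub_zero])
    (fun y hy => by
      rw [hgr (Ω.bd_subset_cl hy), inner_sub_right, hnw y hy, real_inner_comm, hnv y hy, sub_zero])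
  intro x hx
  rw [hψ x hx, hzero x hx, add_zero]

/-- The two velocities of a solution of GePUP-E that agree initially agree at all times. -/
theorem IsGePUPE.eq_of_sameInitial (hν : 0 < ν) (hT : (t₀ : EReal) < T)
    (hg : ForceRegular Ω t₀ T g) (h : IsGePUPE Ω ν lam t₀ T g w u q)
    (hi : SameInitial Ω t₀ w u) : ∀ t ∈ timeCO t₀ T, ∀ x ∈ Ω.cl, w t x = u t x := by
  have h0 := left_mem_timeCO hT
  have hdiv : ∀ t ∈ timeCO t₀ T, ∀ x ∈ Ω.cl, dvg Ω (w t) x = 0 := fun t ht x hx =>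
    heat_eq_zero hν h.regular_w.continuousOn_dvg
      (fun s hs => contDiffOn_dvg_carrier (m := 2) (n := 3) (h.regular_w.contDiffOn_three s hs)
        le_rfl)
      (h.divergenceHeat hg)
      (fun y hy => by
        rw [dvg_congr_cl (hi : EqOn (w t₀) (u t₀) Ω.cl) hy]
        exact h.regular_u.dvg_eq_zero_on_cl h0 (h.projection t₀ h0).2.1 y hy)
      (fun s hs y hy => (h.electric s hs y hy).2) ht hx
  have hnorm : ∀ t ∈ timeCO t₀ T, ∀ x ∈ Ω.bd, (inner ℝ (Ω.normal x) (w t x) : ℝ) = 0 :=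
    fun t ht x hx => eq_zero_of_linear_decay (y := fun s => inner ℝ (Ω.normal x) (w s x))
      (continuousOn_const.inner (h.regular_w.continuousOn_time (Ω.bd_subset_cl hx)))
      (fun s hs => h.normalDecay hg s hs x hx)
      (by
        rw [hi x (Ω.bd_subset_cl hx), real_inner_comm]
        exact h.no_penetration t₀ h0 x hx) ht
  exact fun t ht => eq_of_isLerayProjection (h.regular_u.contDiffOn_one t ht)
    (h.regular_w.contDiffOn_one t ht) (h.projection t ht)
    (fun x hx => hdiv t ht x (Ω.carrier_subset_cl hx)) (hnorm t ht)

theorem dt_congr (h : ∀ t ∈ timeCO t₀ T, ∀ x ∈ Ω.cl, w t x = u t x) (ht : t ∈ timeOO t₀ T)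
    (hx : x ∈ Ω.cl) : dt w t x = dt u t x := by
  refine Filter.EventuallyEq.deriv_eq ?_
  filter_upwards [isOpen_timeOO.mem_nhds ht] with s hs using h s (timeOO_subset_timeCO hs) x hx

theorem IsGePUPE.isINSE (hν : 0 < ν) (hT : (t₀ : EReal) < T)
    (hg : ForceRegular Ω t₀ T g) (h : IsGePUPE Ω ν lam t₀ T g w u q)
    (hi : SameInitial Ω t₀ w u) : IsINSE Ω ν t₀ T g u q := by
  have heq := h.eq_of_sameInitial hν hT hg hi
  refine ⟨h.regular_u, h.regular_q, fun t ht x hx => ?_, fun t ht => (h.projection t ht).2.1,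
    fun t ht x hx => ?_⟩
  · have hxc := Ω.carrier_subset_cl hx
    have hE : EqOn (w t) (u t) Ω.cl := heq t (timeOO_subset_timeCO ht)
    rw [← dt_congr heq ht hxc, ← lap_congr_cl hE hxc, h.momentum t ht x hx]
    abel
  -- By no penetration `u` is itself a tangent vector; testing the electric condition with `τ = u =
  -- w` gives `‖u‖² = 0`.
  · have := (h.electric t ht x hx).1 (u t x) (h.no_penetration t ht x hx)
    rw [heq t ht x (Ω.bd_subset_cl hx)] at this
    exact inner_self_eq_zero.1 this

theorem IsINSE.momentum' (h : IsINSE Ω ν t₀ T g u p) (ht : t ∈ timeOO t₀ T)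
    (x : Euc D) (hx : x ∈ Ω.carrier) :
    dt u t x = g t x - convect Ω (u t) x - grad Ω (p t) x + ν • lap Ω (u t) x := by
  rw [eq_sub_of_add_eq (h.momentum t ht x hx)]
  abel

theorem IsINSE.no_penetration (h : IsINSE Ω ν t₀ T g u p) (ht : t ∈ timeCO t₀ T)
    (hx : x ∈ Ω.bd) : inner ℝ (u t x) (Ω.normal x) = 0 := by
  rw [h.no_slip t ht x hx, inner_zero_left]

/-- The momentum equation, the electric boundary conditions, the projection property and the
evolution laws of `∇ · w` and `n · w` make up GePUP-E. -/
theorem isGePUPE_of_momentum (hg : ForceRegular Ω t₀ T g) (hw : VelocityRegular Ω t₀ T w)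
    (hu : VelocityRegular Ω t₀ T u) (hq : PressureRegular Ω t₀ T q)
    (hmom : ∀ t ∈ timeOO t₀ T, ∀ x ∈ Ω.carrier,
      dt w t x = g t x - convect Ω (u t) x - grad Ω (q t) x + ν • lap Ω (w t) x)
    (hproj : ∀ t ∈ timeCO t₀ T, IsLerayProjection Ω (w t) (u t))
    (hE : ElectricBC Ω t₀ T w) (hH : DivergenceHeat Ω ν t₀ T w) (hN : NormalDecay Ω lam t₀ T w) :
    IsGePUPE Ω ν lam t₀ T g w u q where
  regular_w := hw
  regular_u := hu
  regular_q := hq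
  momentum := hmom
  electric := hE
  projection := hproj
  no_penetration t ht := (hproj t ht).2.2
  pressure_poisson t ht x hx := by
    have h1 := dvg_dt_of_momentum hg hw hu hq ht (hmom t ht) hx
    -- The time derivative of `∇ · w` is computed twice; equating the results isolates the Poisson
    -- equation. The normal component is treated likewise.
    rw [(hw.hasDerivAt_dvg ht hx).unique (hH t ht x hx)] at h1
    linarith
  pressure_neumann t ht x hx := by
    have h1 := inner_normal_dt_of_momentum hg hw hu hq ht (hmom t ht) hx
    rw [(hw.hasDerivAt_inner_normal ht hx).unique (hN t ht x hx)] at h1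
    linarith

theorem IsINSE.isGePUPE (hg : ForceRegular Ω t₀ T g) (h : IsINSE Ω ν t₀ T g u p) :
    IsGePUPE Ω ν lam t₀ T g u u p := by
  refine isGePUPE_of_momentum hg h.regular_u h.regular_u h.regular_p
    (fun t ht => h.momentum' ht) (fun t ht => ?_) (fun t ht x hx => ?_) (fun t ht x hx => ?_)
    fun t ht x hx => ?_
  -- The zero potential exhibits `u` as its own projection.
  · exact ⟨⟨fun _ => 0, contDiffOn_const, contDiffOn_const, fun x _ => by
      ext i; simp [grad, pd]⟩, h.solenoidal t ht, fun x hx => h.no_penetration ht hx⟩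
  · exact ⟨fun τ _ => by rw [h.no_slip t ht x hx, inner_zero_left],
      h.regular_u.dvg_eq_zero_on_cl ht (h.solenoidal t ht) x (Ω.bd_subset_cl hx)⟩
  · have hz : EqOn (dvg Ω (u t)) (fun _ => 0) Ω.carrier :=
      h.solenoidal t (timeOO_subset_timeCO ht)
    rw [lap_congr_carrier hz hx]
    have : lap Ω (fun _ : Euc D => (0 : ℝ)) x = 0 := by
      have e : ∀ i, pd Ω i (fun _ : Euc D => (0 : ℝ)) = fun _ => 0 := fun i => by
        ext y; simp [pd]
      simp [lap, e]
    rw [this, mul_zero]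
    refine (hasDerivAt_const t (0 : ℝ)).congr_of_eventuallyEq ?_
    filter_upwards [isOpen_timeOO.mem_nhds ht] with s hs
      using h.solenoidal s (timeOO_subset_timeCO hs) x hx
  · rw [h.no_slip t (timeOO_subset_timeCO ht) x hx, inner_zero_right, mul_zero]
    refine (hasDerivAt_const t (0 : ℝ)).congr_of_eventuallyEq ?_
    filter_upwards [isOpen_timeOO.mem_nhds ht] with s hs
    rw [h.no_slip s (timeOO_subset_timeCO hs) x hx, inner_zero_right]

end Momentum

/-! ### Splittings `u = w + ∇φ` of a solution of the INSE. -/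

section Splitting

variable {Ω : C2Domain D} {ν lam t₀ : ℝ} {T : EReal} {g w u : ℝ → Euc D → Euc D}
  {p φ : ℝ → Euc D → ℝ} {t : ℝ} {x : Euc D}

theorem lap_grad {f : Euc D → ℝ} (hf : ContDiffOn ℝ 3 f Ω.carrier) (hx : x ∈ Ω.carrier) :
    lap Ω (grad Ω f) x = grad Ω (lap Ω f) x := by
  have hf2 : ContDiffOn ℝ 2 f Ω.carrier := hf.of_le (by norm_num)
  have hp2 : ∀ j, ContDiffOn ℝ 2 (pd Ω j f) Ω.carrier := fun j =>
    contDiffOn_pd_carrier (m := 2) (n := 3) hf le_rfl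
  have hp1 : ∀ j k, ContDiffOn ℝ 1 (pd Ω k (pd Ω j f)) Ω.carrier := fun j k =>
    contDiffOn_pd_carrier (m := 1) (n := 2) (hp2 j) le_rfl
  have hg2 : ContDiffOn ℝ 2 (grad Ω f) Ω.carrier :=
    contDiffOn_grad_carrier (m := 2) (n := 3) hf le_rfl
  have hg1 : ∀ j, ContDiffOn ℝ 1 (pd Ω j (grad Ω f)) Ω.carrier := fun j =>
    contDiffOn_pd_carrier (m := 1) (n := 2) hg2 le_rfl
  have hxc := Ω.carrier_subset_cl hx
  ext i
  have e1 : grad Ω (lap Ω f) x i = ∑ j, pd Ω i (pd Ω j (pd Ω j f)) x :=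
    pd_sum _ hxc fun j _ => differentiableWithinAt_of_contDiffOn one_ne_zero (hp1 j j) hx
  have e2 : lap Ω (grad Ω f) x i = ∑ j, pd Ω j (pd Ω j (grad Ω f)) x i := by simp [lap]
  rw [e1, e2]
  refine Finset.sum_congr rfl fun j _ => ?_
  have e3 : EqOn (fun y => pd Ω j (grad Ω f) y i) (pd Ω i (pd Ω j f)) Ω.carrier := fun y hy =>
    (pd_apply (Ω.carrier_subset_cl hy)
      (differentiableWithinAt_of_contDiffOn two_ne_zero hg2 hy)).symm.trans (pd_comm hf2 hy)
  rw [← pd_apply hxc (differentiableWithinAt_of_contDiffOn one_ne_zero (hg1 j) hx),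
    pd_congr_carrier e3 hx, pd_comm (hp2 j) hx]

theorem lap_of_grad_eq_sub {v w : Euc D → Euc D} {f : Euc D → ℝ} (hv : ContDiffOn ℝ 1 v Ω.carrier)
    (hw : ContDiffOn ℝ 1 w Ω.carrier) (hf : ContDiffOn ℝ 2 f Ω.carrier)
    (h : ∀ y ∈ Ω.carrier, grad Ω f y = v y - w y) (hx : x ∈ Ω.carrier) :
    lap Ω f x = dvg Ω v x - dvg Ω w x := by
  rw [← dvg_grad hf hx, dvg_congr_carrier h hx,
    dvg_sub (Ω.carrier_subset_cl hx) (differentiableWithinAt_of_contDiffOn one_ne_zero hv hx)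
      (differentiableWithinAt_of_contDiffOn one_ne_zero hw hx)]

/-- Since `∇φ = u - w`, the potential is one degree smoother inside than the velocities. -/
theorem PotentialRegular.contDiffOn_carrier {n : ℕ} (hφ : PotentialRegular Ω t₀ T φ)
    (ht : t ∈ timeCO t₀ T) (hu : ContDiffOn ℝ n (u t) Ω.carrier)
    (hw : ContDiffOn ℝ n (w t) Ω.carrier)
    (h : ∀ y ∈ Ω.cl, grad Ω (φ t) y = u t y - w t y) :
    ContDiffOn ℝ (n + 1 : ℕ) (φ t) Ω.carrier :=
  contDiffOn_succ_of_grad ((hφ.contDiffOn_one t ht).mono Ω.carrier_subset_cl)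
    ((hu.sub hw).congr fun y hy => h y (Ω.carrier_subset_cl hy))

/-- Differentiating `∇φ = u - w` in time and exchanging derivatives; this identifies `∂u/∂t - ∂w/∂t`
as a gradient that the pressure can absorb. -/
theorem PotentialRegular.grad_dt (hφ : PotentialRegular Ω t₀ T φ) (hu : VelocityRegular Ω t₀ T u)
    (hw : VelocityRegular Ω t₀ T w)
    (h : ∀ t ∈ timeCO t₀ T, ∀ y ∈ Ω.cl, grad Ω (φ t) y = u t y - w t y)
    (ht : t ∈ timeOO t₀ T) (hx : x ∈ Ω.carrier) :
    grad Ω (dt φ t) x = dt u t x - dt w t x := by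
  have hxc := Ω.carrier_subset_cl hx
  ext i
  have h1 : HasDerivAt (fun s => pd Ω i (φ s) x) (pd Ω i (dt φ t) x) t :=
    hasDerivAt_pd
      (fun s hs => (hφ.contDiffOn_one s (timeOO_subset_timeCO hs)).mono Ω.carrier_subset_cl)
      (fun s hs y hy => hφ.differentiableAt_time s hs y (Ω.carrier_subset_cl hy))
      (fun s hs => (hφ.contDiffOn_dt s hs).mono Ω.carrier_subset_cl)
      ((hφ.cont_pd_dt i).mono (prod_mono subset_rfl Ω.carrier_subset_cl)) ht hx
  have h2 : HasDerivAt (fun s => (u s x - w s x) i) ((dt u t x - dt w t x) i) t :=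
    (EuclideanSpace.proj (𝕜 := ℝ) i).hasFDerivAt.comp_hasDerivAt t
      ((hu.differentiableAt_time t ht x hxc).hasDerivAt.fun_sub
        (hw.differentiableAt_time t ht x hxc).hasDerivAt)
  refine (h1.congr_of_eventuallyEq ?_).unique h2 |>.trans rfl
  filter_upwards [isOpen_timeOO.mem_nhds ht] with s hs
  rw [← h s (timeOO_subset_timeCO hs) x hxc]
  rfl

/-- A splitting `u = w + ∇φ` of a solution of the INSE whose non-solenoidal velocity `w` obeys the
electric boundary conditions, the heat equation for `∇ · w` and the decay law for `n · w` solves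
GePUP-E with the pressure `p + ∂φ/∂t + ν ∇ · w`. -/
theorem IsINSE.isGePUPE_of_splitting (hg : ForceRegular Ω t₀ T g) (hI : IsINSE Ω ν t₀ T g u p)
    (hw : VelocityRegular Ω t₀ T w) (hφ : PotentialRegular Ω t₀ T φ)
    (hs : ∀ t ∈ timeCO t₀ T, ∀ x ∈ Ω.cl, u t x = w t x + grad Ω (φ t) x)
    (hE : ElectricBC Ω t₀ T w) (hH : DivergenceHeat Ω ν t₀ T w) (hN : NormalDecay Ω lam t₀ T w) :
    IsGePUPE Ω ν lam t₀ T g w u (fun t x => p t x + dt φ t x + ν • dvg Ω (w t) x) := by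
  have hu := hI.regular_u
  have hgr : ∀ t ∈ timeCO t₀ T, ∀ y ∈ Ω.cl, grad Ω (φ t) y = u t y - w t y := fun t ht y hy => by
    rw [hs t ht y hy, add_sub_cancel_left]
  -- The gradient of `∂φ/∂t` is a difference of `C¹` fields, which supplies the second derivative
  -- required of a pressure.
  have hdφ2 : ∀ t ∈ timeOO t₀ T, ContDiffOn ℝ 2 (dt φ t) Ω.carrier := fun t ht =>
    contDiffOn_succ_of_grad (m := 1) ((hφ.contDiffOn_dt t ht).mono Ω.carrier_subset_cl)
      (((hu.contDiffOn_dt t ht).sub (hw.contDiffOn_dt t ht)).congr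
        fun y hy => hφ.grad_dt hu hw hgr ht hy)
  have hdw1 : ∀ t ∈ timeOO t₀ T, ContDiffOn ℝ 1 (dvg Ω (w t)) Ω.cl := fun t ht =>
    contDiffOn_dvg_cl (m := 1) (n := 2) (hw.contDiffOn_two t ht) le_rfl
  have hdw2 : ∀ t ∈ timeOO t₀ T, ContDiffOn ℝ 2 (dvg Ω (w t)) Ω.carrier := fun t ht =>
    contDiffOn_dvg_carrier (m := 2) (n := 3) (hw.contDiffOn_three t ht) le_rfl
  refine isGePUPE_of_momentum hg hw hu ⟨fun t ht => ?_, fun t ht => ?_⟩ (fun t ht x hx => ?_)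
    (fun t ht => ?_) hE hH hN
  · exact ((hI.regular_p.contDiffOn_one t ht).add (hφ.contDiffOn_dt t ht)).add
      ((hdw1 t ht).const_smul ν)
  · exact ((hI.regular_p.contDiffOn_two t ht).add (hdφ2 t ht)).add ((hdw2 t ht).const_smul ν)
  · have ht' := timeOO_subset_timeCO ht
    have hxc := Ω.carrier_subset_cl hx
    have hφ4 : ContDiffOn ℝ 4 (φ t) Ω.carrier := hφ.contDiffOn_carrier (n := 3) ht'
      (hu.contDiffOn_three t ht) (hw.contDiffOn_three t ht) (hgr t ht')
    have hw2 : ContDiffOn ℝ 2 (w t) Ω.carrier :=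
      (hw.contDiffOn_two t ht).mono Ω.carrier_subset_cl
    have hu2 : ContDiffOn ℝ 2 (u t) Ω.carrier :=
      (hu.contDiffOn_two t ht).mono Ω.carrier_subset_cl
    -- Incompressibility of `u` turns the divergence of the splitting into `Δφ = -∇ · w`.
    have hlapφ : EqOn (lap Ω (φ t)) (fun y => -dvg Ω (w t) y) Ω.carrier := fun y hy => by
      rw [lap_of_grad_eq_sub (hu2.of_le (by norm_num)) (hw2.of_le (by norm_num))
        (hφ4.of_le (by norm_num)) (fun z hz => hgr t ht' z (Ω.carrier_subset_cl hz)) hy,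
        hI.solenoidal t ht' y hy, zero_sub]
    have hlap : lap Ω (u t) x = lap Ω (w t) x - grad Ω (dvg Ω (w t)) x := by
      rw [lap_congr_cl (fun y hy => hs t ht' y hy) hxc,
        lap_add hw2 (contDiffOn_grad_carrier (m := 2) (n := 4) hφ4 (by norm_num)) hx,
        lap_grad (hφ4.of_le (by norm_num)) hx, sub_eq_add_neg]
      congr 1
      ext i
      exact (pd_congr_carrier hlapφ hx).trans (pd_neg hxc)
    have hgq : grad Ω (fun x => p t x + dt φ t x + ν • dvg Ω (w t) x) x
        = grad Ω (p t) x + (dt u t x - dt w t x) + ν • grad Ω (dvg Ω (w t)) x := by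
      rw [← hφ.grad_dt hu hw hgr ht hx]
      have d1 := (hI.regular_p.contDiffOn_one t ht).differentiableOn one_ne_zero x hxc
      have d2 := (hφ.contDiffOn_dt t ht).differentiableOn one_ne_zero x hxc
      have d3 := (hdw1 t ht).differentiableOn one_ne_zero x hxc
      ext i
      refine (pd_add hxc (d1.fun_add d2) (d3.fun_const_smul ν)).trans ?_
      rw [pd_add hxc d1 d2, pd_const_smul ν hxc d3]
      rfl
    have hm := hI.momentum' ht x hx
    rw [hlap, smul_sub] at hm
    rw [hgq, hm]
    abel
  -- The projection is written `w = u + ∇ψ`, hence `ψ = -φ`; its interior `C²` regularity, also at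
  -- `t₀`, comes from `u - w` being `C¹`.
  · refine ⟨⟨fun x => -φ t x, (hφ.contDiffOn_one t ht).neg, ?_, fun x hx => ?_⟩,
      hI.solenoidal t ht, fun x hx => hI.no_penetration ht hx⟩
    · exact (hφ.contDiffOn_carrier (n := 1) ht
        ((hu.contDiffOn_one t ht).mono Ω.carrier_subset_cl)
        ((hw.contDiffOn_one t ht).mono Ω.carrier_subset_cl) (hgr t ht)).neg
    · have e : grad Ω (fun x => -φ t x) x = -grad Ω (φ t) x := by
        ext i; exact pd_neg hx
      rw [e, hs t ht x hx, add_neg_cancel_right]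

end Splitting

end GePUP

end

theorem mainTheorem4 {D : ℕ} (Ω : GePUP.C2Domain D) (ν lam : ℝ) (hν : 0 < ν) (hlam : 0 ≤ lam)
    (t₀ : ℝ) (T : EReal) (hT : (t₀ : EReal) < T)
    (g : ℝ → GePUP.Euc D → GePUP.Euc D) (hg : GePUP.ForceRegular Ω t₀ T g) :
    -- GePUP-E with the initial condition: `w = u` at all times, and `(u, q)` solves the INSE
    (∀ (w u : ℝ → GePUP.Euc D → GePUP.Euc D) (q : ℝ → GePUP.Euc D → ℝ),
      GePUP.IsGePUPE Ω ν lam t₀ T g w u q → GePUP.SameInitial Ω t₀ w u →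
        (∀ t ∈ GePUP.timeCO t₀ T, ∀ x ∈ Ω.cl, w t x = u t x) ∧
        GePUP.IsINSE Ω ν t₀ T g u q) ∧
    -- the INSE give GePUP-E (with `w = u` and `q = p`)
    (∀ (u : ℝ → GePUP.Euc D → GePUP.Euc D) (p : ℝ → GePUP.Euc D → ℝ),
      GePUP.IsINSE Ω ν t₀ T g u p → GePUP.IsGePUPE Ω ν lam t₀ T g u u p) ∧
    -- the two formulations have the same velocities `u`
    (∀ u : ℝ → GePUP.Euc D → GePUP.Euc D,
      (∃ p : ℝ → GePUP.Euc D → ℝ, GePUP.IsINSE Ω ν t₀ T g u p) ↔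
      ∃ (w : ℝ → GePUP.Euc D → GePUP.Euc D) (q : ℝ → GePUP.Euc D → ℝ),
        GePUP.IsGePUPE Ω ν lam t₀ T g w u q ∧ GePUP.SameInitial Ω t₀ w u) ∧
    -- the splittings `u = w + ∇φ` of a solution of the INSE that yield GePUP-E
    (∀ (u w : ℝ → GePUP.Euc D → GePUP.Euc D) (p φ : ℝ → GePUP.Euc D → ℝ),
      GePUP.IsINSE Ω ν t₀ T g u p → GePUP.VelocityRegular Ω t₀ T w →
      GePUP.PotentialRegular Ω t₀ T φ →
      (∀ t ∈ GePUP.timeCO t₀ T, ∀ x ∈ Ω.cl, u t x = w t x + GePUP.grad Ω (φ t) x) →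
      ((∃ q : ℝ → GePUP.Euc D → ℝ, GePUP.IsGePUPE Ω ν lam t₀ T g w u q) ↔
        GePUP.ElectricBC Ω t₀ T w ∧ GePUP.DivergenceHeat Ω ν t₀ T w ∧
          GePUP.NormalDecay Ω lam t₀ T w)) := by
  refine ⟨fun w u q h hi => ⟨h.eq_of_sameInitial hν hT hg hi, h.isINSE hν hT hg hi⟩,
    fun u p h => h.isGePUPE hg,
    fun u => ⟨fun ⟨p, h⟩ => ⟨u, p, h.isGePUPE hg, fun _ _ => rfl⟩,
      fun ⟨w, q, h, hi⟩ => ⟨q, h.isINSE hν hT hg hi⟩⟩,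
    fun u w p φ h hw hφ hs => ⟨fun ⟨_, hq⟩ =>
      ⟨hq.electric, hq.divergenceHeat hg, hq.normalDecay hg⟩,
      fun ⟨hE, hH, hN⟩ => ⟨_, h.isGePUPE_of_splitting hg hw hφ hs hE hH hN⟩⟩⟩
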